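/- Let $e>1$ be a rational number. A positive integer $p$ is a period of a string $w$ if $w=(uv)^ku$ for some integer $k\ge 1$ and strings $u,v$ with $|uv|=p$; $w$ is an $e$-repetition if $|w|\ge pe$ for some period $p$ of $w$; and $w$ is $e$-repetition-free if no substring of $w$ is an $e$-repetition. For a string $text$ and $i\ge 1$, let $t_i$ be the length of the shortest suffix of $text[1..i]$ that does not occur in $text[1..i-1]$. Consider algorithms for a random access machine with unit-cost operations on integers of $O(\log n)$ bits ($n$ being the length of the input string), which read a string $text$ sequentially from left to right, can access the letters read so far only by testing whether two of them are equal (so the alphabet is arbitrary and need not be ordered), and can read $t_i$ immediately after reading $text[i]$. Then there is such an algorithm that detects $e$-repetitions online, i.e. after reading the $i$th letter, and before reading the next one, it decides whether $text[1..i]$ is $e$-repetition-free, for each $i$, and that processes every string of length $n$ over any alphabet in $O(n)$ total time and $O(n)$ space (memory cells, including the text), where the constants depend only on $e$. -/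

import Mathlib

universe u

namespace OnlineRep

/-! ### Strings, periods, repetitions -/

/-- `p` is a (positive) period of `w`: `w = (xy)^k x` for some `k ≥ 1` and strings `x`, `y`
with `|xy| = p`. -/
def IsPeriod {α : Type u} (p : ℕ) (w : List α) : Prop :=
  0 < p ∧ ∃ (k : ℕ) (x y : List α), 1 ≤ k ∧ (x ++ y).length = p ∧
    w = (List.replicate k (x ++ y)).flatten ++ x

/-- `w` is an `e`-repetition: `|w| ≥ p * e` for some period `p` of `w`. -/
def IsRepetition {α : Type u} (e : ℚ) (w : List α) : Prop :=
  ∃ p : ℕ, IsPeriod p w ∧ (p : ℚ) * e ≤ (w.length : ℚ)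

/-- `w` is `e`-repetition-free: no substring of `w` is an `e`-repetition. -/
def RepetitionFree {α : Type u} (e : ℚ) (w : List α) : Prop :=
  ∀ v : List α, v <:+: w → ¬ IsRepetition e v

/-- The length of the shortest unioccurrent suffix of `w`, i.e. of the shortest suffix of `w` that
does not occur in `w` without its last letter. (For nonempty `w` such suffixes exist, e.g. `w`.) -/
noncomputable def susLen {α : Type u} (w : List α) : ℕ :=
  sInf {t | ∃ v : List α, v <:+ w ∧ v.length = t ∧ ¬ v <:+: w.dropLast}

/-! ### A random access machine, presented as a small imperative language

Programs have finitely many integer variables (names in a finite type `V`) and finitely many integer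
arrays (names in a finite type `A`). The letters of the text that has been read so far can be
accessed only by testing two of them for equality, so the alphabet carries no order and no encoding.
Each operation has unit cost, and is applied to numbers that fit into a machine word. -/

/-- Integer expressions. -/
inductive Expr (V A : Type) : Type
  | const (k : ℕ)
  | var (x : V)
  | get (a : A) (i : Expr V A)
  /-- the number of letters read so far -/
  | len
  /-- the length of the shortest unioccurrent suffix of the text read so far -/
  | sus
  | add (p q : Expr V A)
  /-- truncated subtraction -/
  | sub (p q : Expr V A)
  | mul (p q : Expr V A)
  /-- integer division, rounded down -/
  | div (p q : Expr V A)

/-- Tests. -/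
inductive Test (V A : Type) : Type
  | le (p q : Expr V A)
  | eq (p q : Expr V A)
  /-- equality of the letters of the text at two positions (counted from `0`) -/
  | sameLetter (p q : Expr V A)
  | not (b : Test V A)
  /-- conjunction, evaluated from left to right and only as far as necessary -/
  | and (b c : Test V A)

/-- Programs. -/
inductive Cmd (V A : Type) : Type
  | skip
  | assign (x : V) (p : Expr V A)
  | put (a : A) (i p : Expr V A)
  | seq (c d : Cmd V A)
  | cond (b : Test V A) (c d : Cmd V A)
  | loop (b : Test V A) (c : Cmd V A)

/-- The contents of the variables and the arrays. -/
structure Store (V A : Type) : Type where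
  var : V → ℕ
  arr : A → ℕ → ℕ

/-- The initial store. -/
def Store.zero (V A : Type) : Store V A := ⟨fun _ => 0, fun _ _ => 0⟩

def Store.setVar {V A : Type} [DecidableEq V] (s : Store V A) (x : V) (k : ℕ) : Store V A :=
  ⟨Function.update s.var x k, s.arr⟩

def Store.setArr {V A : Type} [DecidableEq A] (s : Store V A) (a : A) (i k : ℕ) : Store V A :=
  ⟨s.var, Function.update s.arr a (Function.update (s.arr a) i k)⟩

/-- The number of operations in an expression. -/
def Expr.cost {V A : Type} : Expr V A → ℕ
  | .const _ => 1
  | .var _ => 1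
  | .get _ i => i.cost + 1
  | .len => 1
  | .sus => 1
  | .add p q => p.cost + q.cost + 1
  | .sub p q => p.cost + q.cost + 1
  | .mul p q => p.cost + q.cost + 1
  | .div p q => p.cost + q.cost + 1

/-- The value of an expression; `w` is the text read so far. -/
noncomputable def Expr.val {V A : Type} {α : Type u} (w : List α) (s : Store V A) :
    Expr V A → ℕ
  | .const k => k
  | .var x => s.var x
  | .get a i => s.arr a (i.val w s)
  | .len => w.length
  | .sus => susLen w
  | .add p q => p.val w s + q.val w s
  | .sub p q => p.val w s - q.val w s
  | .mul p q => p.val w s * q.val w s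
  | .div p q => p.val w s / q.val w s

/-- The evaluation of an expression respects the resources of the machine: every number that it
produces is at most `W`, and only the cells `0, …, M - 1` of the arrays are accessed. -/
def Expr.Fits {V A : Type} {α : Type u} (M W : ℕ) (w : List α) (s : Store V A) :
    Expr V A → Prop
  | .const k => k ≤ W
  | .var x => s.var x ≤ W
  | .get a i => i.Fits M W w s ∧ i.val w s < M ∧ s.arr a (i.val w s) ≤ W
  | .len => w.length ≤ W
  | .sus => susLen w ≤ W
  | .add p q => p.Fits M W w s ∧ q.Fits M W w s ∧ p.val w s + q.val w s ≤ W
  | .sub p q => p.Fits M W w s ∧ q.Fits M W w s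
  | .mul p q => p.Fits M W w s ∧ q.Fits M W w s ∧ p.val w s * q.val w s ≤ W
  | .div p q => p.Fits M W w s ∧ q.Fits M W w s ∧ q.val w s ≠ 0

/-- The number of operations in a test. -/
def Test.cost {V A : Type} : Test V A → ℕ
  | .le p q => p.cost + q.cost + 1
  | .eq p q => p.cost + q.cost + 1
  | .sameLetter p q => p.cost + q.cost + 1
  | .not b => b.cost + 1
  | .and b c => b.cost + c.cost + 1

/-- The outcome of a test. -/
def Test.Holds {V A : Type} {α : Type u} (w : List α) (s : Store V A) : Test V A → Prop
  | .le p q => p.val w s ≤ q.val w s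
  | .eq p q => p.val w s = q.val w s
  | .sameLetter p q => w[p.val w s]? = w[q.val w s]?
  | .not b => ¬ b.Holds w s
  | .and b c => b.Holds w s ∧ c.Holds w s

/-- The evaluation of a test respects the resources of the machine, and only letters that have
already been read are accessed. -/
def Test.Fits {V A : Type} {α : Type u} (M W : ℕ) (w : List α) (s : Store V A) :
    Test V A → Prop
  | .le p q => p.Fits M W w s ∧ q.Fits M W w s
  | .eq p q => p.Fits M W w s ∧ q.Fits M W w s
  | .sameLetter p q => p.Fits M W w s ∧ q.Fits M W w s ∧
      p.val w s < w.length ∧ q.val w s < w.length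
  | .not b => b.Fits M W w s
  | .and b c => b.Fits M W w s ∧ (b.Holds w s → c.Fits M W w s)

/-- `Exec M W w c s T s'`: when the text read so far is `w`, the program `c`, started in the store
`s`, halts after `T` steps in the store `s'`, and on the way it uses only the cells `0, …, M - 1` of
each array and only numbers that are at most `W`. -/
inductive Exec {V A : Type} [DecidableEq V] [DecidableEq A] {α : Type u} (M W : ℕ) (w : List α) :
    Cmd V A → Store V A → ℕ → Store V A → Prop
  | skip (s : Store V A) : Exec M W w .skip s 1 s
  | assign (s : Store V A) (x : V) (p : Expr V A) (hp : p.Fits M W w s) :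
      Exec M W w (.assign x p) s (p.cost + 1) (s.setVar x (p.val w s))
  | put (s : Store V A) (a : A) (i p : Expr V A) (hi : i.Fits M W w s) (hp : p.Fits M W w s)
      (hM : i.val w s < M) :
      Exec M W w (.put a i p) s (i.cost + p.cost + 1) (s.setArr a (i.val w s) (p.val w s))
  | seq {s s' s'' : Store V A} {c d : Cmd V A} {T T' : ℕ}
      (hc : Exec M W w c s T s') (hd : Exec M W w d s' T' s'') :
      Exec M W w (.seq c d) s (T + T') s''
  | cond_true {s s' : Store V A} {b : Test V A} {c d : Cmd V A} {T : ℕ}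
      (hf : b.Fits M W w s) (hb : b.Holds w s) (hc : Exec M W w c s T s') :
      Exec M W w (.cond b c d) s (b.cost + T) s'
  | cond_false {s s' : Store V A} {b : Test V A} {c d : Cmd V A} {T : ℕ}
      (hf : b.Fits M W w s) (hb : ¬ b.Holds w s) (hd : Exec M W w d s T s') :
      Exec M W w (.cond b c d) s (b.cost + T) s'
  | loop_stop {s : Store V A} {b : Test V A} {c : Cmd V A}
      (hf : b.Fits M W w s) (hb : ¬ b.Holds w s) :
      Exec M W w (.loop b c) s b.cost s
  | loop_step {s s' s'' : Store V A} {b : Test V A} {c : Cmd V A} {T T' : ℕ}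
      (hf : b.Fits M W w s) (hb : b.Holds w s)
      (hc : Exec M W w c s T s') (hl : Exec M W w (.loop b c) s' T' s'') :
      Exec M W w (.loop b c) s (b.cost + T + T') s''

/-! ### Online algorithms -/

/-- An online algorithm: a program `step` that is executed after each letter is read, keeping the
store from one letter to the next, and a variable `out` that holds the answer (nonzero for yes) for
the current prefix when `step` halts. -/
structure OnlineAlgorithm : Type 1 where
  V : Type
  A : Type
  [fintypeV : Fintype V]
  [fintypeA : Fintype A]
  [decEqV : DecidableEq V]
  [decEqA : DecidableEq A]
  step : Cmd V A
  out : V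

attribute [instance] OnlineAlgorithm.fintypeV OnlineAlgorithm.fintypeA
  OnlineAlgorithm.decEqV OnlineAlgorithm.decEqA

/-- `P.Run M W w T ans s`: the algorithm `P`, started with the empty text and all memory zero, reads
the letters of `w` one by one from left to right. It takes `T` steps altogether, ends in the store
`s`, and `ans` lists its answers, one for each nonempty prefix of `w`. It uses only the cells
`0, …, M - 1` of each array and only numbers that are at most `W`. -/
inductive OnlineAlgorithm.Run (P : OnlineAlgorithm) {α : Type u} (M W : ℕ) :
    List α → ℕ → List Bool → Store P.V P.A → Prop
  | start : P.Run M W [] 0 [] (Store.zero P.V P.A)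
  | read {w : List α} {T T' : ℕ} {ans : List Bool} {s s' : Store P.V P.A} (a : α)
      (h : P.Run M W w T ans s) (hstep : Exec M W (w ++ [a]) P.step s T' s') :
      P.Run M W (w ++ [a]) (T + (1 + T')) (ans ++ [decide (s'.var P.out ≠ 0)]) s'

/-- The number of memory cells in use: one for each variable, `M` for each array, and one for each
of the `n` letters of the text. -/
def OnlineAlgorithm.space (P : OnlineAlgorithm) (M n : ℕ) : ℕ :=
  Fintype.card P.V + Fintype.card P.A * M + n

end OnlineRep

/-! Write e = (b + c)/b. A repetition of period p at the end of the text is then a suffix of x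
letters that recurs p positions earlier with p·c ≤ x·b (`repetitionFree_iff_matchFree`), so only the
matching lengths at the relevant distances have to be known.

Let l = `susLen` - 1, the length of the longest suffix that has occurred before. If all proper
prefixes are free, a repetition at the end pins its period to the scale of l. Its x matching letters
have occurred before, so x ≤ l and p ≤ l·b/c. The repetition itself, trimmed to the least sufficient
length, has not occurred before, so l·b < p(b + c) (`SuffixMatch.susLen_mul_lt`). Hence x > l·c/(b +
c).

The program keeps a list of candidate periods, made when l had the value `base`: the distances up to
2b·base/c at which at least D = `threshold` letters match, D being about base·c/(4(b + c)). The list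
stays valid while base ≤ 2l and at most D letters have been read since. A repetition in this window
has x > 2D, so removing the new letters leaves a match of more than D letters that was seen when the
list was made (`matchFree_iff`). Two candidates at distance d give an earlier match of D letters at
distance d, so freeness forces d·c > D·b. The list therefore has bounded size, and updating and
inspecting it takes constant time per letter.

Making a list costs O(l + 1): a comparison that matches x letters permits a jump of the order of x
(`wp_examine`). This is amortized by a potential that grows with `base` and with the number of
letters read since the list was made (`Alive`, `wp_prepare`): a new list is due only if l has fallen
below base/2 or more than D letters have been read. -/

namespace OnlineRep

/-! ### Matching suffixes -/

/-- The last `x` letters of the prefix of length `i` of `w` agree with the letters `p` positions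
before them. -/
def SuffixMatch {α : Type u} (w : List α) (i p x : ℕ) : Prop :=
  x + p ≤ i ∧ ∀ j, i ≤ j + x → j < i → w[j]? = w[j - p]?

section Strings

variable {α : Type u} {w : List α} {i p x y b c : ℕ}

lemma SuffixMatch.mono (h : SuffixMatch w i p x) (hy : y ≤ x) : SuffixMatch w i p y :=
  ⟨by have := h.1; omega, fun j hj hji => h.2 j (by omega) hji⟩

lemma SuffixMatch.shift {k : ℕ} (h : SuffixMatch w i p x) (hk : k ≤ x) :
    SuffixMatch w (i - k) p (x - k) :=
  ⟨by have := h.1; omega, fun j hj hji => h.2 j (by have := h.1; omega) (by omega)⟩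

lemma suffixMatch_append (v : List α) (hi : i ≤ w.length) :
    SuffixMatch (w ++ v) i p x ↔ SuffixMatch w i p x := by
  unfold SuffixMatch
  refine and_congr_right fun _ => forall_congr' fun j => forall_congr' fun _ =>
    forall_congr' fun hj => ?_
  rw [List.getElem?_append_left (by omega), List.getElem?_append_left (by omega)]

lemma SuffixMatch.succ (h : SuffixMatch w i p x) (hi : w[i]? = w[i - p]?) :
    SuffixMatch w (i + 1) p (x + 1) := by
  refine ⟨by have := h.1; omega, fun j hj hji => ?_⟩
  rcases Nat.lt_succ_iff_lt_or_eq.1 hji with h' | rfl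
  · exact h.2 j (by omega) h'
  · exact hi

lemma SuffixMatch.of_succ (h : SuffixMatch w (i + 1) p (x + 1)) :
    SuffixMatch w i p x ∧ w[i]? = w[i - p]? :=
  ⟨⟨by have := h.1; omega, fun j hj hji => h.2 j (by omega) (by omega)⟩,
    h.2 i (by omega) (by omega)⟩

lemma SuffixMatch.extend (h : SuffixMatch w i p x) (hx : x + p < i)
    (hw : w[i - 1 - x]? = w[i - 1 - x - p]?) : SuffixMatch w i p (x + 1) := by
  refine ⟨by omega, fun j hj hji => ?_⟩
  by_cases hjx : i ≤ j + x
  · exact h.2 j hjx hji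
  · obtain rfl : j = i - 1 - x := by omega
    exact hw

lemma SuffixMatch.letter (h : SuffixMatch w i p (x + 1)) :
    w[i - 1 - x]? = w[i - 1 - x - p]? :=
  have := h.1
  h.2 _ (by omega) (by omega)

/-- Two matches of the same suffix give a match between the two earlier occurrences. -/
lemma SuffixMatch.sub {d : ℕ} (h : SuffixMatch w i p x) (h' : SuffixMatch w i (p + d) x) :
    SuffixMatch w (i - p) d x := by
  refine ⟨by have := h'.1; omega, fun j hj hji => ?_⟩
  have h1 := h.2 (j + p) (by omega) (by omega)
  have h2 := h'.2 (j + p) (by omega) (by omega)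
  rw [Nat.add_sub_cancel] at h1
  rw [show j + p - (p + d) = j - d by omega] at h2
  exact h1.symm.trans h2

/-! ### Repetitions in terms of matching suffixes -/

/-- Removing the first block uv from (uv)^k u leaves (uv)^(k-1) u, which is also a prefix of the
whole string. -/
lemma getElem?_flatten_replicate_append (k : ℕ) (u v : List α) {j : ℕ} (hk : 1 ≤ k)
    (hj : (u ++ v).length ≤ j)
    (hjl : j < ((List.replicate k (u ++ v)).flatten ++ u).length) :
    ((List.replicate k (u ++ v)).flatten ++ u)[j]? =
      ((List.replicate k (u ++ v)).flatten ++ u)[j - (u ++ v).length]? := by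
  obtain ⟨k, rfl⟩ : ∃ l, k = l + 1 := ⟨k - 1, by omega⟩
  have h1 : (List.replicate (k + 1) (u ++ v)).flatten ++ u =
      (u ++ v) ++ ((List.replicate k (u ++ v)).flatten ++ u) := by
    simp [List.replicate_succ]
  have h2 : (List.replicate (k + 1) (u ++ v)).flatten ++ u <+:
      (List.replicate (k + 1) (u ++ v)).flatten ++ (u ++ v) := by
    rw [List.prefix_append_right_inj]; exact List.prefix_append _ _
  have h3 : (List.replicate k (u ++ v)).flatten ++ u <+:
      (List.replicate (k + 1) (u ++ v)).flatten ++ u := by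
    rw [List.replicate_succ', List.flatten_append]
    simp only [List.flatten_cons, List.flatten_nil, List.append_nil, List.append_assoc]
    rw [List.prefix_append_right_inj]; exact List.prefix_append _ _
  rw [h1, List.getElem?_append_right hj, ← h1]
  have hlt : j - (u ++ v).length < ((List.replicate k (u ++ v)).flatten ++ u).length := by
    rw [h1, List.length_append] at hjl; omega
  rw [List.getElem?_eq_getElem hlt]
  exact ((List.prefix_iff_getElem?.1 h3) _ hlt).symm

lemma exists_eq_flatten_replicate_append (hp : 0 < p) : ∀ (n : ℕ) (w : List α), w.length ≤ n →
    p ≤ w.length → (∀ j, p ≤ j → j < w.length → w[j]? = w[j - p]?) →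
    ∃ (k : ℕ) (x y : List α), 1 ≤ k ∧ (x ++ y).length = p ∧
      w = (List.replicate k (x ++ y)).flatten ++ x := by
  intro n
  induction n with
  | zero => intro w h1 h2; omega
  | succ n ih =>
    intro w hn hpw hw
    have hdrop : ∀ j, j < w.length - p → (w.drop p)[j]? = w[j]? := by
      intro j hj
      rw [List.getElem?_drop, hw _ (by omega) (by omega)]
      congr 1; omega
    -- A whole period is removed only if at least one more remains, since the exponent k must be
    -- positive.
    by_cases h2 : p ≤ w.length - p
    · obtain ⟨k, x, y, hk, hxy, heq⟩ := ih (w.drop p) (by simp; omega) (by simpa using h2) (by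
        intro j hj hjl
        rw [List.length_drop] at hjl
        rw [hdrop _ hjl, hdrop _ (by omega), hw _ hj (by omega)])
      refine ⟨k + 1, x, y, by omega, hxy, ?_⟩
      have htake : w.take p = x ++ y := by
        have : (w.drop p).take p = x ++ y := by
          obtain ⟨k, rfl⟩ : ∃ l, k = l + 1 := ⟨k - 1, by omega⟩
          rw [heq, List.replicate_succ, List.flatten_cons, List.append_assoc,
            List.take_left' hxy]
        rw [← this]
        apply List.ext_getElem?
        intro j
        by_cases hj : j < p
        · rw [List.getElem?_take_of_lt hj, List.getElem?_take_of_lt hj, hdrop _ (by omega)]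
        · rw [List.getElem?_take_eq_none (by omega), List.getElem?_take_eq_none (by omega)]
      rw [List.replicate_succ, List.flatten_cons, List.append_assoc, ← heq, ← htake,
        List.take_append_drop]
    · have hx : w.drop p = (w.take p).take (w.length - p) := by
        apply List.ext_getElem?
        intro j
        by_cases hj : j < w.length - p
        · rw [hdrop _ hj, List.getElem?_take_of_lt hj, List.getElem?_take_of_lt (by omega)]
        · rw [List.getElem?_take_eq_none (by omega), List.getElem?_eq_none (by simp; omega)]
      refine ⟨1, (w.take p).take (w.length - p), (w.take p).drop (w.length - p), le_rfl, ?_, ?_⟩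
      · rw [List.take_append_drop, List.length_take]; omega
      · rw [List.take_append_drop, ← hx]
        simp

lemma isPeriod_iff : IsPeriod p w ↔
    0 < p ∧ p ≤ w.length ∧ ∀ j, p ≤ j → j < w.length → w[j]? = w[j - p]? := by
  constructor
  · rintro ⟨hp, k, x, y, hk, hxy, rfl⟩
    refine ⟨hp, ?_, fun j hj hjl => ?_⟩
    · obtain ⟨k, rfl⟩ : ∃ l, k = l + 1 := ⟨k - 1, by omega⟩
      rw [List.replicate_succ, List.flatten_cons, List.append_assoc, List.length_append, hxy]
      omega
    · subst hxy
      exact getElem?_flatten_replicate_append k x y hk hj hjl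
  · rintro ⟨hp, hpw, h⟩
    exact ⟨hp, exists_eq_flatten_replicate_append hp _ w le_rfl hpw h⟩

/-- No prefix of `w` ends with a repetition of exponent at least `(b + c) / b`. -/
def MatchFree {α : Type u} (b c : ℕ) (w : List α) : Prop :=
  ∀ i p x, i ≤ w.length → 0 < p → SuffixMatch w i p x → x * b < p * c

lemma matchFree_append {v : List α} (h : MatchFree b c (w ++ v)) : MatchFree b c w :=
  fun i p x hi hp hm =>
    h i p x (by simp; omega) hp ((suffixMatch_append v hi).2 hm)

lemma matchFree_append_singleton {a : α} : MatchFree b c (w ++ [a]) ↔ MatchFree b c w ∧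
    ∀ p x, 0 < p → SuffixMatch (w ++ [a]) (w.length + 1) p x → x * b < p * c := by
  constructor
  · exact fun h => ⟨matchFree_append h, fun p x hp hm => h _ p x (by simp) hp hm⟩
  · rintro ⟨h1, h2⟩ i p x hi hp hm
    rw [List.length_append, List.length_singleton] at hi
    rcases Nat.lt_succ_iff_lt_or_eq.1 (Nat.lt_succ_of_le hi) with h | rfl
    · exact h1 i p x (by omega) hp ((suffixMatch_append _ (by omega)).1 hm)
    · exact h2 p x hp hm

lemma matchFree_of_infix {v : List α} (h : MatchFree b c w) (hv : v <:+: w) :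
    MatchFree b c v := by
  obtain ⟨s, t, rfl⟩ := hv
  have h' := matchFree_append h
  intro i p x hi hp hm
  refine h' (s.length + i) p x (by simp; omega) hp ⟨by have := hm.1; omega, fun j hj hji => ?_⟩
  have := hm.1
  have := hm.2 (j - s.length) (by omega) (by omega)
  rw [List.getElem?_append_right (by omega), List.getElem?_append_right (by omega), this]
  congr 1; omega

/-- A string of length p + x with period p is a match of x letters at distance p, and p·e ≤ p + x
becomes p·c ≤ x·b. -/
lemma repetitionFree_iff_matchFree {e : ℚ} (hb : 0 < b) (he : e * b = b + c) :
    RepetitionFree e w ↔ MatchFree b c w := by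
  have hb' : (0 : ℚ) < b := by exact_mod_cast hb
  have key : ∀ p n : ℕ, (p : ℚ) * e ≤ n ↔ p * (b + c) ≤ n * b := by
    intro p n
    rw [← mul_le_mul_iff_left₀ hb', mul_assoc, he]
    exact_mod_cast Iff.rfl
  constructor
  · intro h i p x hi hp hm
    by_contra! hlt
    obtain ⟨h1, h2⟩ := hm
    have hlen : ((w.drop (i - (x + p))).take (x + p)).length = x + p := by
      simp; omega
    refine h ((w.drop (i - (x + p))).take (x + p))
      ((List.take_prefix _ _).isInfix.trans (List.drop_suffix _ _).isInfix)
      ⟨p, isPeriod_iff.2 ⟨hp, by omega, fun j hj hjl => ?_⟩, ?_⟩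
    · rw [hlen] at hjl
      rw [List.getElem?_take_of_lt (by omega), List.getElem?_take_of_lt (by omega),
        List.getElem?_drop, List.getElem?_drop, h2 _ (by omega) (by omega)]
      congr 1; omega
    · rw [hlen, key]; nlinarith
  · rintro h v hv ⟨p, hper, hlen⟩
    obtain ⟨hp, hpv, hw⟩ := isPeriod_iff.1 hper
    rw [key] at hlen
    have := matchFree_of_infix h hv v.length p (v.length - p) le_rfl hp
      ⟨by omega, fun j hj hjl => hw j (by omega) hjl⟩
    obtain ⟨k, hk⟩ := Nat.exists_eq_add_of_le hpv
    rw [hk] at this hlen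
    rw [Nat.add_sub_cancel_left] at this
    nlinarith

/-! ### The shortest unioccurrent suffix -/

lemma susLen_le {v : List α} (hv : v <:+ w) (h : ¬ v <:+: w.dropLast) : susLen w ≤ v.length :=
  Nat.sInf_le ⟨v, hv, rfl, h⟩

lemma not_infix_dropLast_self (hw : w ≠ []) : ¬ w <:+: w.dropLast := fun h => by
  have := h.length_le
  have := List.length_pos_of_ne_nil hw
  rw [List.length_dropLast] at *
  omega

lemma susLen_le_length (w : List α) : susLen w ≤ w.length := by
  rcases eq_or_ne w [] with rfl | hw
  · have : {t | ∃ v : List α, v <:+ [] ∧ v.length = t ∧ ¬ v <:+: ([] : List α).dropLast} = ∅ := by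
      ext t; simp
    rw [susLen, this]; simp
  · exact susLen_le (List.suffix_refl w) (not_infix_dropLast_self hw)

lemma exists_susLen (hw : w ≠ []) :
    ∃ v : List α, v <:+ w ∧ v.length = susLen w ∧ ¬ v <:+: w.dropLast :=
  Nat.sInf_mem (s := {t | ∃ v : List α, v <:+ w ∧ v.length = t ∧ ¬ v <:+: w.dropLast})
    ⟨_, w, List.suffix_refl w, rfl, not_infix_dropLast_self hw⟩

lemma infix_dropLast_of_lt {v : List α} (hv : v <:+ w) (h : v.length < susLen w) :
    v <:+: w.dropLast := by
  by_contra hn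
  exact absurd (susLen_le hv hn) (by omega)

/-- If va occurred in w, then v would occur in w without its last letter. Hence l grows by at most
one per letter, which bounds it by `base` plus the number of letters read since the list was made.
-/
lemma susLen_append_singleton (w : List α) (a : α) : susLen (w ++ [a]) ≤ susLen w + 1 := by
  rcases eq_or_ne w [] with rfl | hw
  · exact (susLen_le_length _).trans (by simp)
  · obtain ⟨v, ⟨r, rfl⟩, hl, hn⟩ := exists_susLen hw
    rw [← hl]
    refine (susLen_le (v := v ++ [a]) ⟨r, by simp⟩ ?_).trans (by simp)
    rw [List.dropLast_concat]
    rintro ⟨s, t, h⟩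
    apply hn
    rw [← h]
    refine ⟨s, (a :: t).dropLast, ?_⟩
    rw [show s ++ (v ++ [a]) ++ t = (s ++ v) ++ (a :: t) by simp,
      List.dropLast_append_of_ne_nil (by simp)]

/-- A suffix that occurs `p` positions earlier is shorter than every unioccurrent suffix. -/
lemma SuffixMatch.lt_susLen (h : SuffixMatch w w.length p x) (hp : 0 < p) : x < susLen w := by
  have hw : w ≠ [] := by
    rintro rfl; have := h.1; simp at this; omega
  by_contra! hx
  obtain ⟨v, hv, hl, hn⟩ := exists_susLen hw
  apply hn
  have h1 := (h.mono hx).1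
  have h2 := (h.mono hx).2
  rw [← hl] at h1 h2
  have hvd := List.suffix_iff_eq_drop.1 hv
  -- The earlier occurrence ends p ≥ 1 letters before the end, hence inside `w.dropLast`.
  have hv' : v = (w.dropLast.drop (w.length - v.length - p)).take v.length := by
    apply List.ext_getElem?
    intro j
    by_cases hj : j < v.length
    · rw [List.getElem?_take_of_lt hj, List.getElem?_drop, List.getElem?_dropLast,
        if_pos (by omega)]
      conv_lhs => rw [hvd]
      rw [List.getElem?_drop, h2 _ (by omega) (by omega)]
      congr 1; omega
    · rw [List.getElem?_take_eq_none (by omega), List.getElem?_eq_none (by omega)]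
  rw [hv']
  exact (List.take_prefix _ _).isInfix.trans (List.drop_suffix _ _).isInfix

/-- In a string whose proper prefixes are free, no repetition at the end has occurred before. -/
lemma SuffixMatch.susLen_le (h : SuffixMatch w w.length p x) (hp : 0 < p) (hx : p * c ≤ x * b)
    (hf : MatchFree b c w.dropLast) : susLen w ≤ p + x := by
  by_contra! hlt
  have h1 := h.1
  have hl : (w.drop (w.length - (p + x))).length = p + x := by simp; omega
  have hin := infix_dropLast_of_lt (List.drop_suffix (w.length - (p + x)) w) (by omega)
  have := matchFree_of_infix hf hin (p + x) p x (by omega) hp ⟨by omega, fun j hj hji => by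
    rw [List.getElem?_drop, List.getElem?_drop, h.2 _ (by omega) (by omega)]
    congr 1; omega⟩
  omega

/-- The period of a first repetition is comparable to the length of the longest suffix that has
occurred before. -/
lemma SuffixMatch.susLen_mul_lt (h : SuffixMatch w w.length p x) (hp : 0 < p) (hb : 0 < b)
    (hc : 0 < c) (hx : p * c ≤ x * b) (hf : MatchFree b c w.dropLast) :
    (susLen w - 1) * b < p * (b + c) := by
  -- z + 1 = ⌈p·c/b⌉ is the least number of matching letters that makes a repetition of period p.
  obtain ⟨z, hz, hzx⟩ : ∃ z, z * b < p * c ∧ p * c ≤ (z + 1) * b := by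
    have hpc : 0 < p * c := by positivity
    refine ⟨(p * c - 1) / b, ?_, ?_⟩
    · have := Nat.div_mul_le_self (p * c - 1) b
      omega
    · have := Nat.lt_div_mul_add (a := p * c - 1) hb
      rw [add_mul]; omega
  have hzx' : z + 1 ≤ x := by
    by_contra! hh
    have : x * b ≤ z * b := Nat.mul_le_mul_right _ (by omega)
    omega
  have := (h.mono hzx').susLen_le hp hzx hf
  have : (susLen w - 1) * b ≤ (p + z) * b := Nat.mul_le_mul_right _ (by omega)
  nlinarith

end Strings

/-! ### Reasoning about executions -/

section Wp

variable {V A : Type} [DecidableEq V] [DecidableEq A] {α : Type u} {M W : ℕ} {w : List α}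
  {s : Store V A} {Q R : Store V A → ℕ → Prop}

/-- The program `c`, started in `s`, halts in a store and after a number of steps that
satisfy `Q`. -/
def Wp (M W : ℕ) (w : List α) (c : Cmd V A) (s : Store V A) (Q : Store V A → ℕ → Prop) : Prop :=
  ∃ T s', Exec M W w c s T s' ∧ Q s' T

lemma Wp.mono {c : Cmd V A} (h : Wp M W w c s Q) (hQ : ∀ s' t, Q s' t → R s' t) :
    Wp M W w c s R :=
  let ⟨T, s', h1, h2⟩ := h
  ⟨T, s', h1, hQ _ _ h2⟩

lemma wp_skip (h : Q s 1) : Wp M W w .skip s Q := ⟨_, _, .skip s, h⟩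

lemma wp_assign {x : V} {p : Expr V A} (hp : p.Fits M W w s)
    (h : Q (s.setVar x (p.val w s)) (p.cost + 1)) : Wp M W w (.assign x p) s Q :=
  ⟨_, _, .assign s x p hp, h⟩

lemma wp_put {a : A} {i p : Expr V A} (hi : i.Fits M W w s) (hp : p.Fits M W w s)
    (hM : i.val w s < M)
    (h : Q (s.setArr a (i.val w s) (p.val w s)) (i.cost + p.cost + 1)) :
    Wp M W w (.put a i p) s Q :=
  ⟨_, _, .put s a i p hi hp hM, h⟩

lemma wp_seq {c d : Cmd V A}
    (h : Wp M W w c s fun s' t => Wp M W w d s' fun s'' t' => Q s'' (t + t')) :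
    Wp M W w (.seq c d) s Q :=
  let ⟨_, _, h1, _, _, h2, h3⟩ := h
  ⟨_, _, .seq h1 h2, h3⟩

lemma wp_cond {b : Test V A} {c d : Cmd V A} (hf : b.Fits M W w s)
    (hc : b.Holds w s → Wp M W w c s fun s' t => Q s' (b.cost + t))
    (hd : ¬ b.Holds w s → Wp M W w d s fun s' t => Q s' (b.cost + t)) :
    Wp M W w (.cond b c d) s Q := by
  by_cases hb : b.Holds w s
  · obtain ⟨_, _, h1, h2⟩ := hc hb
    exact ⟨_, _, .cond_true hf hb h1, h2⟩
  · obtain ⟨_, _, h1, h2⟩ := hd hb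
    exact ⟨_, _, .cond_false hf hb h1, h2⟩

lemma wp_loop_exit {b : Test V A} {c : Cmd V A} (hf : b.Fits M W w s) (hb : ¬ b.Holds w s)
    (h : Q s b.cost) : Wp M W w (.loop b c) s Q := by
  refine ⟨b.cost, s, ?_, h⟩
  constructor <;> assumption

/-- The rule for loops, with an invariant `I` of the store and the time spent so far, and a
bound `f` for the number of iterations to come. -/
lemma wp_loop {b : Test V A} {c : Cmd V A} (I : Store V A → ℕ → Prop) (f : Store V A → ℕ)
    (h0 : I s 0) (hf : ∀ s t, I s t → b.Fits M W w s)
    (hstep : ∀ s t, I s t → b.Holds w s →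
      Wp M W w c s fun s' t' => I s' (t + b.cost + t') ∧ f s' < f s)
    (hQ : ∀ s t, I s t → ¬ b.Holds w s → Q s (t + b.cost)) :
    Wp M W w (.loop b c) s Q := by
  suffices H : ∀ n s t, f s ≤ n → I s t →
      Wp M W w (.loop b c) s fun s' t' => Q s' (t + t') by
    simpa using H _ s 0 le_rfl h0
  intro n
  induction n with
  | zero =>
    intro s t hn hI
    by_cases hb : b.Holds w s
    · obtain ⟨T, s', -, -, h3⟩ := hstep s t hI hb
      omega
    · exact wp_loop_exit (hf s t hI) hb (hQ s t hI hb)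
  | succ n ih =>
    intro s t hn hI
    by_cases hb : b.Holds w s
    · obtain ⟨T, s', h1, h2, h3⟩ := hstep s t hI hb
      obtain ⟨T', s'', h4, h5⟩ := ih s' _ (by omega) h2
      refine ⟨_, _, .loop_step (hf s t hI) hb h1 h4, ?_⟩
      rwa [add_assoc, add_assoc, ← add_assoc b.cost] at h5
    · exact wp_loop_exit (hf s t hI) hb (hQ s t hI hb)

end Wp

@[simp] lemma Store.setVar_var {V A : Type} [DecidableEq V] (s : Store V A) (x y : V) (k : ℕ) :
    (s.setVar x k).var y = if y = x then k else s.var y := by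
  simp [Store.setVar, Function.update_apply]

@[simp] lemma Store.setVar_arr {V A : Type} [DecidableEq V] (s : Store V A) (x : V) (k : ℕ) :
    (s.setVar x k).arr = s.arr := rfl

@[simp] lemma Store.setArr_var {V A : Type} [DecidableEq A] (s : Store V A) (a : A) (i k : ℕ) :
    (s.setArr a i k).var = s.var := rfl

@[simp] lemma Store.setArr_arr {V A : Type} [DecidableEq A] (s : Store V A) (a a' : A)
    (i i' k : ℕ) :
    (s.setArr a i k).arr a' i' = if a' = a ∧ i' = i then k else s.arr a' i' := by
  by_cases h : a' = a
  · subst h; simp [Store.setArr, Function.update_apply]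
  · simp [Store.setArr, h]

/-! ### The program -/

/-- The variables of the detector. -/
inductive Reg : Type
  /-- nonzero when a repetition has been found -/
  | found
  | answer
  /-- the length of the longest suffix that had occurred before, when the list of candidate
  periods was built -/
  | base
  /-- the length of the text when the list of candidate periods was built -/
  | start
  /-- the number of candidate periods -/
  | count
  | idx
  | period
  | ext
  deriving DecidableEq

instance : Fintype Reg :=
  ⟨{.found, .answer, .base, .start, .count, .idx, .period, .ext}, fun x => by cases x <;> decide⟩

/-- The arrays of the detector: the candidate periods, and how far the text matches itself
at each of these distances. -/
inductive Table : Type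
  | period
  | ext
  deriving DecidableEq

instance : Fintype Table := ⟨{.period, .ext}, fun x => by cases x <;> decide⟩

namespace Detector

/-- Candidate periods are those for which at least this many letters match. -/
def threshold (b c base : ℕ) : ℕ := base * c / (4 * (b + c))

/-- Periods reach about 2b·base/c at spacing `gap`, and base < 4(b + c)·gap. -/
def maxCount (b c : ℕ) : ℕ := 8 * (b + c) * b + 1

abbrev E := Expr Reg Table

def reg (x : Reg) : E := .var x

def thresholdExpr (b c : ℕ) : E := .div (.mul (reg .base) (.const c)) (.const (4 * (b + c)))

def longest : E := .sub .sus (.const 1)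

def lastLetter : E := .sub .len (.const 1)

/-- Extend or reset the match of every candidate after a new letter. -/
def update : Cmd Reg Table :=
  .seq (.assign .idx (.const 0)) <|
  .loop (.le (.add (reg .idx) (.const 1)) (reg .count)) <|
  .seq
    (.cond (.sameLetter lastLetter (.sub lastLetter (.get .period (reg .idx))))
      (.put .ext (reg .idx) (.add (.get .ext (reg .idx)) (.const 1)))
      (.put .ext (reg .idx) (.const 0)))
    (.assign .idx (.add (reg .idx) (.const 1)))

/-- Compare the text with itself at the distance `period`. -/
def compare (b c : ℕ) : Cmd Reg Table :=
  -- The first conjunct is evaluated first and keeps both letter positions inside the text, so the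
  -- truncated subtractions are exact. The second stops the comparison once the match makes a
  -- repetition.
  .loop (.and (.le (.add (.add (reg .ext) (reg .period)) (.const 1)) .len)
      (.and (.le (.add (.mul (reg .ext) (.const b)) (.const 1))
          (.mul (reg .period) (.const c)))
        (.sameLetter (.sub lastLetter (reg .ext))
          (.sub (.sub lastLetter (reg .ext)) (reg .period)))))
    (.assign .ext (.add (reg .ext) (.const 1)))

/-- Increase `period` by all the distances that are not possible after a match of `p` letters. -/
def jump (b c : ℕ) (p : E) : Cmd Reg Table :=
  .assign .period
    (.add (reg .period) (.add (.div (.mul p (.const b)) (.const c)) (.const 1)))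

/-- Examine the distance `period` and proceed to the next one. -/
def examine (b c : ℕ) : Cmd Reg Table :=
  .seq (.assign .ext (.const 0)) <|
  .seq (compare b c) <|
  .cond (.le (thresholdExpr b c) (reg .ext))
    (.seq (.put .period (reg .count) (reg .period)) <|
      .seq (.put .ext (reg .count) (reg .ext)) <|
      .seq (.assign .count (.add (reg .count) (.const 1)))
        -- The jump uses the threshold and not the full match: another candidate is only known to
        -- share that many letters.
        (jump b c (thresholdExpr b c)))
    (jump b c (reg .ext))

/-- While the list is in use, a repetition has p·c ≤ x·b with x ≤ l ≤ 2·base, whence the bound on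
the periods. -/
def scan (b c : ℕ) : Cmd Reg Table :=
  .loop (.and (.le (.add (reg .period) (.const 1)) .len)
      (.le (.mul (reg .period) (.const c)) (.mul (reg .base) (.const (2 * b)))))
    (examine b c)

/-- Make a new list of candidate periods. -/
def rebuild (b c : ℕ) : Cmd Reg Table :=
  .seq (.assign .base longest) <|
  .seq (.assign .start .len) <|
  .seq (.assign .count (.const 0)) <|
  .seq (.assign .period (.const 1)) (scan b c)

/-- Look for a candidate period whose match has become long enough. -/
def inspect (b c : ℕ) : Cmd Reg Table :=
  .seq (.assign .idx (.const 0)) <|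
  .loop (.le (.add (reg .idx) (.const 1)) (reg .count)) <|
  .seq
    (.cond (.le (.mul (.get .period (reg .idx)) (.const c))
        (.mul (.get .ext (reg .idx)) (.const b)))
      (.assign .found (.const 1)) .skip)
    (.assign .idx (.add (reg .idx) (.const 1)))

/-- Extensions of a string that is not free are not free, so nothing is done after the first
repetition. -/
def step (b c : ℕ) : Cmd Reg Table :=
  .cond (.eq (reg .found) (.const 0))
    (.seq
      (.cond (.and (.le (reg .base) (.mul (.const 2) longest))
          (.le .len (.add (reg .start) (thresholdExpr b c))))
        update (rebuild b c))
      (.seq (inspect b c) (.assign .answer (.sub (.const 1) (reg .found)))))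
    .skip

end Detector

def detector (b c : ℕ) : OnlineAlgorithm where
  V := Reg
  A := Table
  step := Detector.step b c
  out := .answer

namespace Detector

/-! ### Candidate periods -/

section Candidates

variable {α : Type u} {w : List α} {s s' : Store Reg Table} {b c : ℕ}

/-- Every candidate period carries the length of its match, unless that is already long enough for
a repetition. -/
def Tracked (b c : ℕ) (w : List α) (s : Store Reg Table) : Prop :=
  ∀ j < s.var .count, 0 < s.arr .period j ∧
    SuffixMatch w w.length (s.arr .period j) (s.arr .ext j) ∧
    ((∀ y, SuffixMatch w w.length (s.arr .period j) y → y ≤ s.arr .ext j) ∨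
      s.arr .period j * c ≤ s.arr .ext j * b)

/-- Every period that may become relevant before the next list is made is a candidate. -/
def Complete (b c : ℕ) (w : List α) (s : Store Reg Table) : Prop :=
  ∀ p < s.var .start, p * c ≤ s.var .base * (2 * b) → 0 < p →
    SuffixMatch w (s.var .start) p (threshold b c (s.var .base)) →
    ∃ j < s.var .count, s.arr .period j = p

lemma threshold_le (b c n : ℕ) : threshold b c n ≤ n := by
  refine Nat.div_le_of_le_mul ?_
  nlinarith [Nat.zero_le (n * b), Nat.zero_le (n * c)]

lemma threshold_mul_le (b c n : ℕ) : threshold b c n * (4 * (b + c)) ≤ n * c :=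
  Nat.div_mul_le_self _ _

lemma lt_threshold_mul (hb : 0 < b) (n : ℕ) :
    n * c < (threshold b c n + 1) * (4 * (b + c)) := by
  have := Nat.lt_div_mul_add (a := n * c) (b := 4 * (b + c)) (by omega)
  rw [add_mul, one_mul]; exact this

/-- The factor 4 in `threshold` is spent here: one 2 absorbs n ≤ 2l, the other leaves twice the
threshold below l·c/(b + c) < x. -/
lemma two_mul_threshold_lt {n p x : ℕ} (hb : 0 < b) (hc : 0 < c)
    (h : SuffixMatch w w.length p x) (hp : 0 < p) (hx : p * c ≤ x * b)
    (hf : MatchFree b c w.dropLast) (hn : n ≤ 2 * (susLen w - 1)) :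
    2 * threshold b c n < x := by
  have h1 := h.susLen_mul_lt hp hb hc hx hf
  have h2 := threshold_mul_le b c n
  set l := susLen w - 1
  set D := threshold b c n
  have h3 : n * c ≤ 2 * l * c := Nat.mul_le_mul_right _ hn
  have h4 : 2 * D * (b + c) ≤ l * c := by nlinarith
  have h5 : 2 * D * (b + c) * b ≤ l * c * b := Nat.mul_le_mul_right _ h4
  have h6 : l * b * c < p * (b + c) * c := Nat.mul_lt_mul_of_pos_right h1 hc
  have h7 : p * c * (b + c) ≤ x * b * (b + c) := Nat.mul_le_mul_right _ hx
  have h8 : 2 * D * (b * (b + c)) < x * (b * (b + c)) := by nlinarith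
  exact Nat.lt_of_mul_lt_mul_right h8

lemma matchFree_iff (hb : 0 < b) (hc : 0 < c) (hw : w ≠ []) (hf : MatchFree b c w.dropLast)
    (ht : Tracked b c w s) (hs : s.var .start ≤ w.length)
    (hl : Complete b c w s)
    (hlow : s.var .base ≤ 2 * (susLen w - 1))
    (hlen : w.length ≤ s.var .start + threshold b c (s.var .base))
    (hup : susLen w - 1 ≤ s.var .base + (w.length - s.var .start)) :
    MatchFree b c w ↔ ∀ j < s.var .count, s.arr .ext j * b < s.arr .period j * c := by
  constructor
  · exact fun h j hj => h _ _ _ le_rfl (ht j hj).1 (ht j hj).2.1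
  · intro h
    obtain ⟨v, a, h⟩ := (List.eq_nil_or_concat w).resolve_left hw
    rw [List.concat_eq_append] at h
    subst h
    rw [List.dropLast_concat] at hf
    refine matchFree_append_singleton.2 ⟨hf, fun p x hp hm => ?_⟩
    by_contra! hx
    replace hm : SuffixMatch (v ++ [a]) (v ++ [a]).length p x := by simpa using hm
    have h1 := two_mul_threshold_lt hb hc hm hp hx (by simpa using hf) hlow
    have h2 := hm.lt_susLen hp
    have h3 := threshold_le b c (s.var .base)
    have h4 := hm.1
    -- Dropping the letters read since `start`, at most D of them, leaves more than D matching
    -- letters.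
    have h5 := hm.shift (k := (v ++ [a]).length - s.var .start) (by omega)
    rw [Nat.sub_sub_self hs] at h5
    have h6 := h5.1
    obtain ⟨j, hj, rfl⟩ := hl p (by omega) (hx.trans (by
      have : x * b ≤ (2 * s.var .base) * b := Nat.mul_le_mul_right _ (by omega)
      nlinarith)) hp (h5.mono (by omega))
    have h7 := h j hj
    rcases (ht j hj).2.2 with h8 | h8
    · have := Nat.mul_le_mul_right b (h8 x hm)
      omega
    · omega

end Candidates

/-! ### Verification of the program -/

section Verification

variable {α : Type u} {M W : ℕ} {w : List α} {s s' : Store Reg Table} {b c : ℕ}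

/-- The numbers up to `W` suffice for a text of length `n`. -/
def Roomy (b c n W : ℕ) : Prop := 16 * (b + c + 1) ^ 2 * (n + 1) ≤ W

lemma Roomy.mul_le {n u v : ℕ} (h : Roomy b c n W) (hu : u ≤ 4 * (b + c + 1) * (n + 1))
    (hv : v ≤ 4 * (b + c + 1)) : u * v ≤ W := by
  refine le_trans ?_ h
  calc u * v ≤ (4 * (b + c + 1) * (n + 1)) * (4 * (b + c + 1)) := Nat.mul_le_mul hu hv
    _ = _ := by ring

lemma Roomy.le {n u : ℕ} (h : Roomy b c n W) (hu : u ≤ 16 * (b + c + 1) * (n + 1)) : u ≤ W := by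
  refine hu.trans (le_trans ?_ h)
  gcongr
  nlinarith [Nat.zero_le (b + c)]

lemma Roomy.maxCount_le {n : ℕ} (h : Roomy b c n W) : maxCount b c + 3 ≤ W := by
  refine le_trans ?_ h
  unfold maxCount
  have : 16 * (b + c + 1) ^ 2 * 1 ≤ 16 * (b + c + 1) ^ 2 * (n + 1) := by gcongr; omega
  nlinarith [Nat.zero_le (b * b), Nat.zero_le (c * b), Nat.zero_le (c * c)]

lemma le_linear {n k m : ℕ} (h : m ≤ k * (n + 1)) (hk : k ≤ 16 * (b + c + 1)) :
    m ≤ 16 * (b + c + 1) * (n + 1) :=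
  h.trans (Nat.mul_le_mul_right _ hk)

lemma wp_update (hW : Roomy b c w.length W) (hM : maxCount b c < M) (hw : 0 < w.length)
    (hm : s.var .count ≤ maxCount b c)
    (hs : ∀ j < s.var .count, s.arr .period j + s.arr .ext j < w.length) :
    Wp M W w update s fun s' t =>
      (∀ x, x ≠ .idx → s'.var x = s.var x) ∧ s'.arr .period = s.arr .period ∧
      (∀ j < s.var .count,
        (w[w.length - 1]? = w[w.length - 1 - s.arr .period j]? →
          s'.arr .ext j = s.arr .ext j + 1) ∧
        (w[w.length - 1]? ≠ w[w.length - 1 - s.arr .period j]? → s'.arr .ext j = 0)) ∧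
      t ≤ 40 * (s.var .count + 1) := by
  have hmW := hW.maxCount_le
  have hnW : w.length + 1 ≤ W := hW.le (le_linear (k := 1) (by omega) (by omega))
  refine wp_seq (wp_assign (by simp [Expr.Fits]) ?_)
  refine wp_loop (fun s' t => (∀ x, x ≠ .idx → s'.var x = s.var x) ∧
      s'.arr .period = s.arr .period ∧ s'.var .idx ≤ s.var .count ∧
      (∀ j < s'.var .idx,
        (w[w.length - 1]? = w[w.length - 1 - s.arr .period j]? →
          s'.arr .ext j = s.arr .ext j + 1) ∧
        (w[w.length - 1]? ≠ w[w.length - 1 - s.arr .period j]? → s'.arr .ext j = 0)) ∧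
      (∀ j, s'.var .idx ≤ j → s'.arr .ext j = s.arr .ext j) ∧ t ≤ 40 * s'.var .idx)
    (fun s' => s.var .count - s'.var .idx) ?_ ?_ ?_ ?_
  · simp +contextual [Expr.val]
  · rintro s' t ⟨h1, h2, h3, h4, h5, h6⟩
    simp only [Test.Fits, Expr.Fits, reg, Expr.val, h1 .count (by decide)]
    omega
  · rintro s' t ⟨h1, h2, h3, h4, h5, h6⟩ hb
    simp only [Test.Holds, Expr.val, reg, h1 .count (by decide)] at hb
    have hsj := hs (s'.var .idx) (by omega)
    refine wp_seq (wp_cond ?_ ?_ ?_)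
    · simp only [Test.Fits, Expr.Fits, lastLetter, reg, Expr.val, h2]
      omega
    · intro hb'
      simp only [Test.Holds, Expr.val, reg, lastLetter, h2] at hb'
      refine wp_put ?_ ?_ ?_ (wp_assign ?_ ?_)
      · simp only [Expr.Fits, reg]; omega
      · simp only [Expr.Fits, reg, Expr.val, h5 _ le_rfl]; omega
      · simp only [Expr.val, reg]; omega
      · simp only [Expr.Fits, reg, Expr.val, Store.setArr_var]; omega
      · simp only [Expr.val, Expr.cost, Test.cost, reg, lastLetter, Store.setVar_var,
          Store.setVar_arr, Store.setArr_var, Store.setArr_arr, h5 _ le_rfl]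
        refine ⟨⟨fun x hx => by simp [hx, h1 x hx], ?_, by simp; omega, ?_, ?_, by simp; omega⟩,
          by simp; omega⟩
        · ext j; simp [h2]
        · intro j hj
          simp only [if_true] at hj
          by_cases hji : j = s'.var .idx
          · subst hji
            simp [hb']
          · simpa [hji] using h4 j (by omega)
        · intro j hj
          simp only [if_true] at hj
          simpa [show j ≠ s'.var .idx by omega] using h5 j (by omega)
    · intro hb'
      simp only [Test.Holds, Expr.val, reg, lastLetter, h2] at hb'
      refine wp_put ?_ ?_ ?_ (wp_assign ?_ ?_)
      · simp only [Expr.Fits, reg]; omega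
      · simp only [Expr.Fits]; omega
      · simp only [Expr.val, reg]; omega
      · simp only [Expr.Fits, reg, Expr.val, Store.setArr_var]; omega
      · simp only [Expr.val, Expr.cost, Test.cost, reg, lastLetter, Store.setVar_var,
          Store.setVar_arr, Store.setArr_var, Store.setArr_arr]
        refine ⟨⟨fun x hx => by simp [hx, h1 x hx], ?_, by simp; omega, ?_, ?_, by simp; omega⟩,
          by simp; omega⟩
        · ext j; simp [h2]
        · intro j hj
          simp only [if_true] at hj
          by_cases hji : j = s'.var .idx
          · subst hji
            simp [hb']
          · simpa [hji] using h4 j (by omega)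
        · intro j hj
          simp only [if_true] at hj
          simpa [show j ≠ s'.var .idx by omega] using h5 j (by omega)
  · rintro s' t ⟨h1, h2, h3, h4, h5, h6⟩ hb
    simp only [Test.Holds, Expr.val, reg, h1 .count (by decide)] at hb
    refine ⟨h1, h2, fun j hj => h4 j (by omega), ?_⟩
    simp only [Expr.cost, Test.cost, reg]
    omega

/-- A match cut short because it already made a repetition cannot be present before the new letter,
since w is free. All stored lengths are then exact, and one comparison of letters updates each. -/
lemma tracked_update {a : α} (hf : MatchFree b c w) (ht : Tracked b c w s)
    (hcount : s'.var .count = s.var .count) (hper : s'.arr .period = s.arr .period)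
    (hext : ∀ j < s.var .count,
        ((w ++ [a])[w.length]? = (w ++ [a])[w.length - s.arr .period j]? →
          s'.arr .ext j = s.arr .ext j + 1) ∧
        ((w ++ [a])[w.length]? ≠ (w ++ [a])[w.length - s.arr .period j]? →
          s'.arr .ext j = 0)) :
    Tracked b c (w ++ [a]) s' := by
  intro j hj
  rw [hcount] at hj
  obtain ⟨h1, h2, h3⟩ := ht j hj
  rw [hper, List.length_append, List.length_singleton]
  refine ⟨h1, ?_⟩
  have h4 := (suffixMatch_append [a] le_rfl).2 h2
  by_cases h : (w ++ [a])[w.length]? = (w ++ [a])[w.length - s.arr .period j]?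
  · rw [(hext j hj).1 h]
    refine ⟨h4.succ h, ?_⟩
    rcases h3 with h3 | h3
    · refine Or.inl fun y hy => ?_
      rcases y with _ | y
      · omega
      · have := h3 y ((suffixMatch_append [a] le_rfl).1 hy.of_succ.1)
        omega
    · exact absurd (hf _ _ _ le_rfl h1 h2) (by omega)
  · rw [(hext j hj).2 h]
    refine ⟨⟨by have := h2.1; omega, fun i hi hi' => by omega⟩, Or.inl fun y hy => ?_⟩
    rcases y with _ | y
    · omega
    · exact absurd hy.of_succ.2 h

lemma wp_inspect (hW : Roomy b c w.length W) (hM : maxCount b c < M)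
    (hm : s.var .count ≤ maxCount b c) (h0 : s.var .found = 0)
    (hs : ∀ j < s.var .count, s.arr .period j + s.arr .ext j ≤ w.length) :
    Wp M W w (inspect b c) s fun s' t =>
      (∀ x, x ≠ .idx → x ≠ .found → s'.var x = s.var x) ∧ s'.arr = s.arr ∧
      s'.var .found ≤ 1 ∧
      (s'.var .found = 0 ↔ ∀ j < s.var .count, s.arr .ext j * b < s.arr .period j * c) ∧
      t ≤ 40 * (s.var .count + 1) := by
  have hmW := hW.maxCount_le
  have hnW : w.length + 1 ≤ W := hW.le (le_linear (k := 1) (by omega) (by omega))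
  have hcW : b + c + 1 ≤ W := hW.le (by nlinarith [Nat.zero_le ((b + c) * w.length)])
  have hlin : w.length ≤ 4 * (b + c + 1) * (w.length + 1) := by nlinarith
  refine wp_seq (wp_assign (by simp [Expr.Fits]) ?_)
  refine wp_loop (fun s' t => (∀ x, x ≠ .idx → x ≠ .found → s'.var x = s.var x) ∧
      s'.arr = s.arr ∧ s'.var .idx ≤ s.var .count ∧ s'.var .found ≤ 1 ∧
      (s'.var .found = 0 ↔ ∀ j < s'.var .idx, s.arr .ext j * b < s.arr .period j * c) ∧
      t ≤ 40 * s'.var .idx)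
    (fun s' => s.var .count - s'.var .idx) ?_ ?_ ?_ ?_
  · simp +contextual [h0, Expr.val]
  · rintro s' t ⟨h1, h2, h3, h4, h5, h6⟩
    simp only [Test.Fits, Expr.Fits, reg, Expr.val, h1 .count (by decide) (by decide)]
    omega
  · rintro s' t ⟨h1, h2, h3, h4, h5, h6⟩ hb
    simp only [Test.Holds, Expr.val, reg, h1 .count (by decide) (by decide)] at hb
    have hsj := hs (s'.var .idx) (by omega)
    have e1 : s.arr .period (s'.var .idx) * c ≤ W := hW.mul_le (by omega) (by omega)
    have e2 : s.arr .ext (s'.var .idx) * b ≤ W := hW.mul_le (by omega) (by omega)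
    refine wp_seq (wp_cond ?_ ?_ ?_)
    · simp only [Test.Fits, Expr.Fits, reg, Expr.val, h2]
      omega
    · intro hb'
      simp only [Test.Holds, Expr.val, reg, h2] at hb'
      refine wp_assign ?_ (wp_assign ?_ ?_)
      · simp only [Expr.Fits]; omega
      · simp only [Expr.Fits, reg, Expr.val, Store.setVar_var]; simp; omega
      · simp only [Expr.val, Expr.cost, Test.cost, reg, Store.setVar_var, Store.setVar_arr]
        refine ⟨⟨fun x hx hx' => by simp [hx, hx', h1 x hx hx'], h2, by simp; omega, by simp,
          ?_, by simp; omega⟩, by simp; omega⟩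
        simp only [reduceCtorEq, if_false, if_true, one_ne_zero, false_iff]
        exact fun h => absurd (h (s'.var .idx) (by omega)) (by omega)
    · intro hb'
      simp only [Test.Holds, Expr.val, reg, h2] at hb'
      refine wp_skip (wp_assign ?_ ?_)
      · simp only [Expr.Fits, reg, Expr.val]; omega
      · simp only [Expr.val, Expr.cost, Test.cost, reg, Store.setVar_var, Store.setVar_arr]
        refine ⟨⟨fun x hx hx' => by simp [hx, h1 x hx hx'], h2, by simp; omega, by simp [h4],
          ?_, by simp; omega⟩, by simp; omega⟩
        simp only [reduceCtorEq, if_false, if_true]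
        rw [h5]
        constructor
        · intro h j hj
          rcases Nat.lt_succ_iff_lt_or_eq.1 hj with h' | rfl
          · exact h j h'
          · omega
        · exact fun h j hj => h j (by omega)
  · rintro s' t ⟨h1, h2, h3, h4, h5, h6⟩ hb
    simp only [Test.Holds, Expr.val, reg, h1 .count (by decide) (by decide)] at hb
    refine ⟨h1, h2, h4, ?_, ?_⟩
    · rw [h5, show s'.var .idx = s.var .count by omega]
    · simp only [Expr.cost, Test.cost, reg]
      omega

lemma wp_compare (hW : Roomy b c w.length W) (h0 : s.var .ext = 0) (hp0 : 0 < s.var .period)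
    (hp : s.var .period < w.length) :
    Wp M W w (compare b c) s fun s' t =>
      ∃ x, s' = s.setVar .ext x ∧ SuffixMatch w w.length (s.var .period) x ∧
        ((∀ y, SuffixMatch w w.length (s.var .period) y → y ≤ x) ∨
          s.var .period * c ≤ x * b) ∧
        x * b ≤ s.var .period * c + b ∧ t ≤ 40 * (x + 1) := by
  have hnW : 2 * w.length + 1 ≤ W :=
    hW.le (le_linear (k := 2) (by omega) (by omega))
  have hcW : b + c + 1 ≤ W := hW.le (by nlinarith [Nat.zero_le ((b + c) * w.length)])
  have hlin : w.length + 1 ≤ 4 * (b + c + 1) * (w.length + 1) := by nlinarith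
  have e1 : s.var .period * c ≤ W := hW.mul_le (by omega) (by omega)
  refine wp_loop (fun s' t => ∃ x, s' = s.setVar .ext x ∧
      SuffixMatch w w.length (s.var .period) x ∧ x * b ≤ s.var .period * c + b ∧ t ≤ 40 * x)
    (fun s' => w.length - s'.var .ext) ?_ ?_ ?_ ?_
  · refine ⟨0, ?_, ⟨by omega, fun j hj hj' => by omega⟩, by omega, by omega⟩
    rw [← h0]
    simp [Store.setVar, Function.update_eq_self]
  · rintro _ t ⟨x, rfl, h1, h2, h3⟩
    have h4 := h1.1
    have e2 : x * b + 1 ≤ W := by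
      have h5 : (x + 1) * (b + 1) ≤ W := hW.mul_le (by omega) (by omega)
      nlinarith
    simp [Test.Fits, Expr.Fits, reg, Expr.val, lastLetter]
    omega
  · rintro _ t ⟨x, rfl, h1, h2, h3⟩ hb
    have h4 := h1.1
    simp [Test.Holds, Expr.val, reg, lastLetter] at hb
    obtain ⟨hb1, hb2, hb3⟩ := hb
    refine wp_assign ?_ ⟨⟨x + 1, ?_, h1.extend (by omega) hb3, by nlinarith, ?_⟩, ?_⟩
    · simp [Expr.Fits, Expr.val, reg]; omega
    · simp [Store.setVar, Expr.val, reg]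
    · simp only [Test.cost, Expr.cost, reg, lastLetter]; omega
    · simp [Expr.val, reg]; omega
  · rintro _ t ⟨x, rfl, h1, h2, h3⟩ hb
    refine ⟨x, rfl, h1, ?_, h2, ?_⟩
    -- If a longer match existed and the current one were too short for a repetition, the next
    -- letters would agree and the loop would go on.
    · by_contra! hn
      obtain ⟨⟨y, hy, hxy⟩, hlt⟩ := hn
      apply hb
      have := hy.1
      have := (hy.mono hxy).letter
      simp [Test.Holds, Expr.val, reg, lastLetter]
      exact ⟨by omega, by omega, this⟩
    · simp only [Test.cost, Expr.cost, reg, lastLetter]; omega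

end Verification

/-! ### Correctness and cost of building the list of candidate periods -/

section Scan

variable {α : Type u} {M W : ℕ} {w : List α} {s s' : Store Reg Table} {b c : ℕ}

/-- Two candidate periods differ by at least this number. -/
def gap (b c n : ℕ) : ℕ := threshold b c n * b / c + 1

lemma lt_div_add_one_mul (hc : 0 < c) (n : ℕ) : n < (n / c + 1) * c := by
  have := Nat.lt_div_mul_add (a := n) hc
  rw [add_mul]; omega

lemma threshold_lt_gap_mul (hb : 0 < b) (hc : 0 < c) (n : ℕ) :
    threshold b c n < gap b c n * c :=
  (Nat.le_mul_of_pos_right _ hb).trans_lt (lt_div_add_one_mul hc _)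

/-- The spacing of candidates is a constant fraction of n, so both the size of the list and the cost
of a long comparison can be measured in gaps. -/
lemma lt_gap (hb : 0 < b) (hc : 0 < c) (n : ℕ) : n < 4 * (b + c) * gap b c n := by
  have h1 := lt_threshold_mul (c := c) hb n
  have h2 := Nat.mul_le_mul_right (4 * (b + c)) (threshold_lt_gap_mul hb hc n)
  refine Nat.lt_of_mul_lt_mul_right (a := c) (h1.trans_le (h2.trans (by linarith)))

lemma gap_mul_le (b c n : ℕ) : gap b c n * c ≤ n * b + c := by
  have h1 := Nat.div_mul_le_self (threshold b c n * b) c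
  have h2 := Nat.mul_le_mul_right b (threshold_le b c n)
  rw [gap, add_mul]; omega

/-- The candidate list under construction: all the distances below `period` have been examined. -/
structure Scanning (b c : ℕ) (w : List α) (s : Store Reg Table) : Prop where
  base_eq : s.var .base = susLen w - 1
  start_eq : s.var .start = w.length
  period_pos : 0 < s.var .period
  tracked : Tracked b c w s
  listed : ∀ p < s.var .period, 0 < p → SuffixMatch w w.length p (threshold b c (s.var .base)) →
    ∃ j < s.var .count, s.arr .period j = p
  count_mul_lt : s.var .count * gap b c (s.var .base) < s.var .period
  period_mul_le : s.var .period * c ≤ s.var .base * (2 * b) + gap b c (s.var .base) * c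

/-- Every candidate takes up one gap, and the scan overshoots its range by at most one gap. -/
lemma Scanning.count_le (h : Scanning b c w s) (hb : 0 < b) (hc : 0 < c) :
    s.var .count ≤ maxCount b c := by
  have h1 := lt_gap hb hc (s.var .base)
  have h2 := Nat.mul_le_mul_right c h.count_mul_lt.le
  have h3 := h.period_mul_le
  set g := gap b c (s.var .base)
  have h4 : s.var .base * (2 * b) ≤ 4 * (b + c) * g * (2 * b) := Nat.mul_le_mul_right _ h1.le
  have h5 : 4 * (b + c) * g * (2 * b) * 1 ≤ 4 * (b + c) * g * (2 * b) * c :=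
    Nat.mul_le_mul_left _ hc
  have hg : 0 < g * c := Nat.mul_pos (Nat.succ_pos _) hc
  refine Nat.le_of_mul_le_mul_right (c := g * c) ?_ hg
  unfold maxCount
  nlinarith

lemma Scanning.count_lt (h : Scanning b c w s) (hb : 0 < b) (hc : 0 < c)
    (hp : s.var .period * c ≤ s.var .base * (2 * b)) :
    s.var .count < maxCount b c := by
  have h1 := lt_gap hb hc (s.var .base)
  have h2 := Nat.mul_lt_mul_of_pos_right h.count_mul_lt hc
  set g := gap b c (s.var .base)
  have h4 : s.var .base * (2 * b) ≤ 4 * (b + c) * g * (2 * b) := Nat.mul_le_mul_right _ h1.le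
  have h5 : 4 * (b + c) * g * (2 * b) * 1 ≤ 4 * (b + c) * g * (2 * b) * c :=
    Nat.mul_le_mul_left _ hc
  refine Nat.lt_of_mul_lt_mul_right (a := g * c) ?_
  unfold maxCount
  nlinarith

/-- No period is jumped over. -/
lemma Scanning.jump_listed (h : Scanning b c w s) (hw : 0 < w.length)
    (hf : MatchFree b c w.dropLast) {x y : ℕ}
    (hx : SuffixMatch w w.length (s.var .period) x) (hyx : y ≤ x)
    (hy : y ≤ threshold b c (s.var .base)) {p : ℕ} (hp : s.var .period < p)
    (hpj : p < s.var .period + (y * b / c + 1)) :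
    ¬ SuffixMatch w w.length p (threshold b c (s.var .base)) := by
  intro hm
  obtain ⟨d, rfl⟩ := Nat.exists_eq_add_of_lt hp
  have h1 := (hx.mono hyx).sub (d := d + 1) (by simpa [add_assoc] using hm.mono hy)
  have h2 := h1.1
  have hpos := h.period_pos
  have hne : w ≠ [] := List.length_pos_iff.1 hw
  have h3 : SuffixMatch w.dropLast (w.length - s.var .period) (d + 1) y := by
    refine (suffixMatch_append [w.getLast hne] (by simp; omega)).1 ?_
    rwa [List.dropLast_append_getLast hne]
  -- The match between the two earlier occurrences ends `period` ≥ 1 letters before the end, so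
  -- freeness of `w.dropLast` applies.
  have h4 := hf _ _ _ (by simp; omega) (by omega) h3
  have h5 : (d + 1) * c ≤ y * b / c * c := Nat.mul_le_mul_right _ (by omega)
  have h6 := Nat.div_mul_le_self (y * b) c
  omega

/-- The number of steps that it takes to examine distances, per unit of distance. -/
def scanRate (b c : ℕ) : ℕ := 400 * (b + c) + 200

lemma le_gap_of_mul_le {n p x : ℕ} (hb : 0 < b) (hc : 0 < c) (hx : x * b ≤ p * c + b)
    (hp : p * c ≤ n * (2 * b)) : x ≤ 8 * (b + c) * gap b c n := by
  have h1 := lt_gap hb hc n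
  have h2 : x ≤ 2 * n + 1 := Nat.le_of_mul_le_mul_right (c := b) (by nlinarith) hb
  nlinarith

/-- The steps are charged to the increase of `period`. After x < D matches the jump exceeds x·b/c.
After at least D matches the jump is a full gap, and x = O(gap) because the comparison stops at a
repetition. -/
lemma wp_examine (hb : 0 < b) (hc : 0 < c) (hW : Roomy b c w.length W) (hM : maxCount b c < M)
    (hf : MatchFree b c w.dropLast) (h : Scanning b c w s) (hp : s.var .period < w.length)
    (hpc : s.var .period * c ≤ s.var .base * (2 * b)) :
    Wp M W w (examine b c) s fun s' t => Scanning b c w s' ∧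
      s'.var .found = s.var .found ∧ s'.var .answer = s.var .answer ∧
      s.var .period < s'.var .period ∧
      t + scanRate b c * s.var .period ≤ scanRate b c * s'.var .period := by
  have hmW := hW.maxCount_le
  have hnW : 6 * w.length + 1 ≤ W := hW.le (le_linear (k := 6) (by omega) (by omega))
  have hcW : 4 * (b + c) + 1 ≤ W := hW.le (by nlinarith [Nat.zero_le ((b + c) * w.length)])
  have hlin : w.length + 1 ≤ 4 * (b + c + 1) * (w.length + 1) := by nlinarith
  have hbase : s.var .base ≤ w.length := by
    have := susLen_le_length w
    rw [h.base_eq]; omega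
  have hcount := h.count_lt hb hc hpc
  have hbc : s.var .base * c ≤ W := hW.mul_le (by omega) (by omega)
  have hD := threshold_le b c (s.var .base)
  have hjump : ∀ x ≤ w.length, x * b ≤ W ∧ s.var .period + (x * b / c + 1) ≤ W := by
    intro x hx
    refine ⟨hW.mul_le (by omega) (by omega), ?_⟩
    have h1 : x * b / c ≤ x * b := Nat.div_le_self _ _
    have h2 : x * b ≤ w.length * b := Nat.mul_le_mul_right _ hx
    have h3 : w.length + (w.length * b + 1) ≤ W :=
      hW.le (le_linear (k := b + 1) (by nlinarith) (by omega))
    omega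
  refine wp_seq (wp_assign (by simp [Expr.Fits]) (wp_seq ?_))
  refine (wp_compare hW (by simp [Expr.val]) (by simpa using h.period_pos)
    (by simpa using hp)).mono ?_
  rintro _ t ⟨x, rfl, hx1, hx2, hx3, ht⟩
  simp only [Store.setVar_var, reduceCtorEq, if_false] at hx1 hx2 hx3
  have hxl := hx1.1
  have hxg := le_gap_of_mul_le hb hc hx3 hpc
  have hrate : ∀ y, 1 ≤ y → x ≤ 8 * (b + c) * y → t + 80 ≤ scanRate b c * y := by
    intro y hy hxy
    unfold scanRate
    nlinarith [Nat.zero_le ((b + c) * y)]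
  refine wp_cond ?_ ?_ ?_
  · simp [Test.Fits, Expr.Fits, thresholdExpr, reg, Expr.val]
    omega
  · intro hge
    simp [Test.Holds, thresholdExpr, reg, Expr.val] at hge
    change threshold b c (s.var .base) ≤ x at hge
    refine wp_seq (wp_put ?_ ?_ ?_ (wp_seq (wp_put ?_ ?_ ?_ (wp_seq (wp_assign ?_
      (wp_assign ?_ ?_))))))
    · simp [Expr.Fits, reg]; omega
    · simp [Expr.Fits, reg]; omega
    · simp [Expr.val, reg]; omega
    · simp [Expr.Fits, reg]; omega
    · simp [Expr.Fits, reg]; omega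
    · simp [Expr.val, reg]; omega
    · simp [Expr.Fits, Expr.val, reg]; omega
    · have h1 := hjump (threshold b c (s.var .base)) (by omega)
      have h2 : threshold b c (s.var .base) * b / c ≤ threshold b c (s.var .base) * b :=
        Nat.div_le_self _ _
      simp [Expr.Fits, Expr.val, reg, thresholdExpr]
      simp only [← threshold.eq_1]
      omega
    · have hr := hrate _ (by simp [gap]) hxg
      have hg : 0 < gap b c (s.var .base) := by simp [gap]
      refine ⟨⟨?_, ?_, ?_, ?_, ?_, ?_, ?_⟩, ?_, ?_, ?_, ?_⟩
      · simpa [Expr.val, reg] using h.base_eq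
      · simpa [Expr.val, reg] using h.start_eq
      · simp [Expr.val, reg]
      · intro j hj
        simp [Expr.val, reg] at hj ⊢
        by_cases hjc : j = s.var .count
        · subst hjc
          simpa using ⟨h.period_pos, hx1, hx2⟩
        · simpa [hjc] using h.tracked j (by omega)
      · intro p
        simp [Expr.val, reg, thresholdExpr]
        simp only [← threshold.eq_1]
        intro hp1 hp2 hp3
        rcases lt_trichotomy p (s.var .period) with h1 | rfl | h1
        · obtain ⟨j, hj, rfl⟩ := h.listed p h1 hp2 hp3
          exact ⟨j, by omega, by simp [hj.ne]⟩
        · exact ⟨s.var .count, by omega, by simp⟩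
        · exact absurd hp3 (h.jump_listed (by omega) hf hx1 hge le_rfl h1 hp1)
      · have := h.count_mul_lt
        simp [Expr.val, reg, thresholdExpr]
        simp only [← threshold.eq_1, ← gap.eq_1]
        rw [add_mul]; omega
      · simp [Expr.val, reg, thresholdExpr]
        simp only [← threshold.eq_1, ← gap.eq_1]
        rw [add_mul]; omega
      · simp
      · simp
      · simp [Expr.val, reg]
      · simp [Expr.val, reg, thresholdExpr, Expr.cost, Test.cost]
        simp only [← threshold.eq_1, ← gap.eq_1]
        rw [mul_add]; omega
  · intro hlt
    simp [Test.Holds, thresholdExpr, reg, Expr.val] at hlt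
    change x < threshold b c (s.var .base) at hlt
    have hj := hjump x (by omega)
    have hmul : x * b ≤ threshold b c (s.var .base) * b := Nat.mul_le_mul_right _ hlt.le
    have hle : x * b / c + 1 ≤ gap b c (s.var .base) := by
      have := Nat.div_le_div_right (c := c) hmul
      simp only [gap]; omega
    have hxc : x ≤ 8 * (b + c) * (x * b / c + 1) := by
      have h1 := lt_div_add_one_mul hc (x * b)
      have h2 : x * 1 ≤ x * b := Nat.mul_le_mul_left _ hb
      nlinarith [Nat.zero_le (b * (x * b / c + 1))]
    have hr := hrate _ (Nat.le_add_left 1 _) hxc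
    have hdiv : x * b / c ≤ x * b := Nat.div_le_self _ _
    refine wp_assign ?_ ?_
    · simp [Expr.Fits, Expr.val, reg]
      omega
    · refine ⟨⟨?_, ?_, ?_, ?_, ?_, ?_, ?_⟩, ?_, ?_, ?_, ?_⟩
      · simpa [Expr.val, reg] using h.base_eq
      · simpa [Expr.val, reg] using h.start_eq
      · simp [Expr.val, reg]
      · simpa [Tracked] using h.tracked
      · intro p
        simp [Expr.val, reg]
        intro hp1 hp2 hp3
        rcases lt_trichotomy p (s.var .period) with h1 | rfl | h1
        · exact h.listed p h1 hp2 hp3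
        · exfalso
          -- With fewer than D matching letters, either the match is maximal, or it makes a
          -- repetition and so has more than 2D letters.
          rcases hx2 with h1 | h1
          · exact absurd (h1 _ hp3) (by omega)
          · have := two_mul_threshold_lt (n := s.var .base) hb hc hx1 h.period_pos h1 hf
              (by rw [h.base_eq]; omega)
            omega
        · exact absurd hp3 (h.jump_listed (by omega) hf hx1 le_rfl hlt.le h1 hp1)
      · simp [Expr.val, reg]
        exact h.count_mul_lt.trans_le (Nat.le_add_right _ _)
      · have := Nat.mul_le_mul_right c hle
        simp [Expr.val, reg]
        rw [add_mul]; omega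
      · simp
      · simp
      · simp [Expr.val, reg]
      · simp [Expr.val, reg, thresholdExpr, Expr.cost, Test.cost]
        rw [mul_add]; omega

lemma wp_rebuild (hb : 0 < b) (hc : 0 < c) (hW : Roomy b c w.length W) (hM : maxCount b c < M)
    (hw : 0 < w.length) (hf : MatchFree b c w.dropLast) :
    Wp M W w (rebuild b c) s fun s' t =>
      s'.var .base = susLen w - 1 ∧ s'.var .start = w.length ∧
      s'.var .found = s.var .found ∧ s'.var .answer = s.var .answer ∧
      Tracked b c w s' ∧ Complete b c w s' ∧ s'.var .count ≤ maxCount b c ∧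
      t ≤ (scanRate b c + 20) * (3 * b * (susLen w - 1) + c) := by
  have hnW : 3 * w.length + 1 ≤ W := hW.le (le_linear (k := 3) (by omega) (by omega))
  have hcW : 4 * (b + c) + 1 ≤ W := hW.le (by nlinarith [Nat.zero_le ((b + c) * w.length)])
  have hlin : w.length + 1 ≤ 4 * (b + c + 1) * (w.length + 1) := by nlinarith
  have hsus := susLen_le_length w
  refine wp_seq (wp_assign ?_ (wp_seq (wp_assign ?_ (wp_seq (wp_assign ?_ (wp_seq
    (wp_assign ?_ ?_)))))))
  · simp [longest, Expr.Fits]; omega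
  · simp [Expr.Fits]; omega
  · simp [Expr.Fits]
  · simp [Expr.Fits]; omega
  -- The extra 20 per unit of distance pays for the loop test. The reserve `scanRate b c`, available
  -- because `period` starts at 1, pays for the initial assignments and the last test.
  refine wp_loop (fun s' t => Scanning b c w s' ∧ s'.var .found = s.var .found ∧
      s'.var .answer = s.var .answer ∧ t + scanRate b c ≤ (scanRate b c + 20) * s'.var .period)
    (fun s' => w.length - s'.var .period) ?_ ?_ ?_ ?_
  · refine ⟨⟨?_, ?_, ?_, ?_, ?_, ?_, ?_⟩, ?_, ?_, ?_⟩
    · simp [Expr.val, longest]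
    · simp [Expr.val]
    · simp [Expr.val]
    · simp [Tracked, Expr.val]
    · intro p hp1 hp2
      simp [Expr.val] at hp1
      omega
    · simp [Expr.val]
    · simp [Expr.val, gap, add_mul]; omega
    · simp
    · simp
    · simp [Expr.val]
  · rintro s' t ⟨h1, h2, h3, h4⟩
    have hp : s'.var .period * c ≤ 3 * (b + c + 1) * (w.length + 1) := by
      have h5 := h1.period_mul_le
      have h6 := gap_mul_le b c (s'.var .base)
      have h7 : s'.var .base ≤ w.length := by rw [h1.base_eq]; omega
      nlinarith
    have hp1 : s'.var .period ≤ s'.var .period * c := Nat.le_mul_of_pos_right _ hc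
    have hp2 : 3 * (b + c + 1) * (w.length + 1) + 1 ≤ W := hW.le (by nlinarith)
    have h8 : s'.var .base * (2 * b) ≤ W := hW.mul_le (by rw [h1.base_eq]; omega) (by omega)
    simp only [Test.Fits, Expr.Fits, reg, Expr.val, h1.base_eq] at h8 ⊢
    omega
  · rintro s' t ⟨h1, h2, h3, h4⟩ hb'
    simp only [Test.Holds, reg, Expr.val] at hb'
    refine (wp_examine hb hc hW hM hf h1 (by omega) hb'.2).mono ?_
    rintro s'' t' ⟨h5, h6, h7, h8, h9⟩
    refine ⟨⟨h5, by omega, by omega, ?_⟩, by omega⟩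
    simp only [Test.cost, Expr.cost, reg]
    rw [add_mul] at h4 ⊢
    omega
  · rintro s' t ⟨h1, h2, h3, h4⟩ hb'
    simp only [Test.Holds, reg, Expr.val, not_and_or, not_le] at hb'
    refine ⟨h1.base_eq, h1.start_eq, h2, h3, h1.tracked, ?_, h1.count_le hb hc, ?_⟩
    · intro p hp1 hp2 hp3 hp4
      rw [h1.start_eq] at hp1 hp4
      refine h1.listed p ?_ hp3 hp4
      -- The scan ends at the length of the text or beyond the bound on periods; p is below both.
      by_contra! hle
      have := Nat.mul_le_mul_right c hle
      omega
    · have h5 := h1.period_mul_le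
      have h6 := gap_mul_le b c (s'.var .base)
      have h7 : s'.var .period ≤ 3 * b * s'.var .base + c :=
        (Nat.le_mul_of_pos_right _ hc).trans (by nlinarith)
      rw [← h1.base_eq]
      refine le_trans ?_ (Nat.mul_le_mul_left _ h7)
      refine le_trans ?_ h4
      simp only [Test.cost, Expr.cost, reg, longest, scanRate]
      omega

end Scan

/-! ### Amortized cost and correctness for one letter -/

section Step

variable {α : Type u} {M W T : ℕ} {w : List α} {s s' : Store Reg Table} {b c : ℕ} {a : α}

/-- The cost of a new candidate list, per unit of `base`. -/
def rebuildRate (b c : ℕ) : ℕ := (scanRate b c + 20) * (3 * b)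

/-- The credit that each letter contributes to the next candidate list. -/
def creditRate (b c : ℕ) : ℕ := 2 * rebuildRate b c * (4 * (b + c) + 1)

/-- The amortized number of steps per letter. -/
def letterRate (b c : ℕ) : ℕ :=
  creditRate b c + (scanRate b c + 20) * c + 100 * (maxCount b c + 1) + 100

/-- The state between two letters, as long as no repetition has been found, after `T` steps. -/
structure Alive (b c : ℕ) (w : List α) (T : ℕ) (s : Store Reg Table) : Prop where
  found_eq : s.var .found = 0
  matchFree : MatchFree b c w
  start_le : s.var .start ≤ w.length
  base_le : s.var .base ≤ w.length
  length_le : w.length ≤ s.var .start + threshold b c (s.var .base)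
  susLen_le : susLen w - 1 ≤ s.var .base + (w.length - s.var .start)
  tracked : Tracked b c w s
  complete : Complete b c w s
  count_le : s.var .count ≤ maxCount b c
  -- Steps plus potential: the terms in `base` and in the letters read since `start` are savings for
  -- the next list.
  time_le : T + rebuildRate b c * s.var .base + creditRate b c * (w.length - s.var .start) ≤
    letterRate b c * w.length

/-- The state after a repetition has been found. -/
structure Dead (b c : ℕ) (w : List α) (T : ℕ) (s : Store Reg Table) : Prop where
  found_eq : s.var .found = 1
  answer_eq : s.var .answer = 0
  not_matchFree : ¬ MatchFree b c w
  time_le : T ≤ letterRate b c * w.length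

lemma alive_zero : Alive b c ([] : List α) 0 (Store.zero Reg Table) := by
  refine ⟨rfl, ?_, by simp [Store.zero], by simp [Store.zero], by simp [Store.zero], ?_, ?_, ?_, by simp [Store.zero],
    by simp [Store.zero]⟩
  · intro i p x hi hp hm
    have := hm.1
    simp at hi
    omega
  · have := susLen_le_length ([] : List α)
    simp at this
    omega
  · simp [Tracked, Store.zero]
  · simp [Complete, Store.zero]

lemma complete_append (h : Complete b c w s) (hs : s.var .start ≤ w.length)
    (hvar : ∀ x, x ≠ .idx → s'.var x = s.var x) (hper : s'.arr .period = s.arr .period) :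
    Complete b c (w ++ [a]) s' := by
  unfold Complete
  rw [hvar .start (by decide), hvar .base (by decide), hvar .count (by decide), hper]
  exact fun p hp1 hp2 hp3 hp4 => h p hp1 hp2 hp3 ((suffixMatch_append [a] hs).1 hp4)

lemma le_of_threshold_lt {n u : ℕ} (hb : 0 < b) (hc : 0 < c) (h : threshold b c n + 1 ≤ u) :
    n ≤ 4 * (b + c) * u :=
  calc n ≤ n * c := Nat.le_mul_of_pos_right _ hc
    _ ≤ (threshold b c n + 1) * (4 * (b + c)) := (lt_threshold_mul hb n).le
    _ ≤ u * (4 * (b + c)) := Nat.mul_le_mul_right _ h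
    _ = 4 * (b + c) * u := mul_comm _ _

/-- Both ways of preparing the candidate list for a new letter. -/
lemma wp_prepare (hb : 0 < b) (hc : 0 < c) (hW : Roomy b c (w.length + 1) W)
    (hM : maxCount b c < M) (h : Alive b c w T s) :
    Wp M W (w ++ [a]) (.cond (.and (.le (reg .base) (.mul (.const 2) longest))
        (.le .len (.add (reg .start) (thresholdExpr b c)))) update (rebuild b c)) s
      fun s' t => s'.var .found = 0 ∧ Tracked b c (w ++ [a]) s' ∧ Complete b c (w ++ [a]) s' ∧
        s'.var .count ≤ maxCount b c ∧ s'.var .start ≤ w.length + 1 ∧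
        s'.var .base ≤ w.length + 1 ∧
        s'.var .base ≤ 2 * (susLen (w ++ [a]) - 1) ∧
        w.length + 1 ≤ s'.var .start + threshold b c (s'.var .base) ∧
        susLen (w ++ [a]) - 1 ≤ s'.var .base + (w.length + 1 - s'.var .start) ∧
        T + t + rebuildRate b c * s'.var .base +
          creditRate b c * (w.length + 1 - s'.var .start) +
          40 * (maxCount b c + 1) + 50 ≤ letterRate b c * (w.length + 1) := by
  have hl : (w ++ [a]).length = w.length + 1 := by simp
  have hsus := susLen_append_singleton w a
  have hsus' := susLen_le_length (w ++ [a])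
  have hsusw := susLen_le_length w
  have hup := h.susLen_le
  have hup' : susLen (w ++ [a]) - 1 ≤ s.var .base + (w.length + 1 - s.var .start) := by
    have := h.start_le
    omega
  have htime := h.time_le
  have hstart := h.start_le
  have hcount := h.count_le
  have hbase := h.base_le
  rw [hl] at hsus'
  have hnW : 3 * (w.length + 1) ≤ W := hW.le (by nlinarith [Nat.zero_le ((b + c) * w.length)])
  have hcW : 4 * (b + c) + 1 ≤ W := hW.le (by nlinarith [Nat.zero_le ((b + c) * w.length)])
  have hbc : s.var .base * c ≤ W := hW.mul_le (by nlinarith) (by omega)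
  have hD := threshold_le b c (s.var .base)
  refine wp_cond ?_ ?_ ?_
  · simp [Test.Fits, Expr.Fits, reg, Expr.val, longest, thresholdExpr]
    simp only [← threshold.eq_1]
    omega
  · intro ht
    simp [Test.Holds, Expr.val, reg, longest, thresholdExpr] at ht
    simp only [← threshold.eq_1] at ht
    refine (wp_update (by rwa [hl]) hM (by omega) hcount (fun j hj => ?_)).mono ?_
    · have := (h.tracked j hj).2.1.1
      omega
    rintro s' t ⟨h1, h2, h3, h4⟩
    rw [hl, Nat.add_sub_cancel] at h3
    have h5 := h1 .found (by decide)
    have h6 := h1 .base (by decide)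
    have h7 := h1 .start (by decide)
    have h8 := h1 .count (by decide)
    rw [h5, h6, h7, h8]
    refine ⟨h.found_eq, tracked_update h.matchFree h.tracked h8 h2 h3,
      complete_append h.complete hstart h1 h2, hcount, by omega, by omega, ht.1, ht.2, hup', ?_⟩
    rw [Nat.sub_add_comm hstart, mul_add (creditRate b c), mul_add (letterRate b c)]
    simp only [Test.cost, Expr.cost, reg, longest, thresholdExpr]
    have : creditRate b c + 100 * (maxCount b c + 1) + 100 ≤ letterRate b c := by
      unfold letterRate; omega
    omega
  · intro ht
    simp [Test.Holds, Expr.val, reg, longest, thresholdExpr] at ht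
    simp only [← threshold.eq_1] at ht
    refine (wp_rebuild hb hc (by rwa [hl]) hM (by omega) (by simpa using h.matchFree)).mono ?_
    rintro s' t ⟨h1, h2, h3, -, h4, h5, h6, h7⟩
    rw [h1, h2, h3, hl]
    refine ⟨h.found_eq, h4, h5, h6, le_rfl, by omega, by omega, by omega, by omega, ?_⟩
    set l := susLen (w ++ [a]) - 1
    -- The savings cover twice the main cost of a list for l: one half pays for making it, the other
    -- becomes the potential of the new `base`. If base > 2l, the old `base` term suffices.
    have hpay : 2 * (rebuildRate b c * l) ≤ rebuildRate b c * s.var .base +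
        creditRate b c * (w.length + 1 - s.var .start) := by
      by_cases hlow : s.var .base ≤ 2 * l
      · have h8 : threshold b c (s.var .base) + 1 ≤ w.length + 1 - s.var .start := by
          have := ht hlow
          omega
        have h9 := le_of_threshold_lt hb hc h8
        set u := w.length + 1 - s.var .start
        -- Here u > D letters have been read, so base ≤ 4(b + c)·u, and l ≤ base + u.
        have h13 : l ≤ (4 * (b + c) + 1) * u := by
          rw [add_mul]; omega
        have h14 := Nat.mul_le_mul_left (2 * rebuildRate b c) h13
        rw [← mul_assoc, ← creditRate, mul_assoc] at h14
        omega
      · have h8 := Nat.mul_le_mul_left (rebuildRate b c) (show 2 * l ≤ s.var .base by omega)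
        rw [mul_left_comm] at h8
        omega
    have ht' : t ≤ rebuildRate b c * l + (scanRate b c + 20) * c := by
      refine h7.trans (le_of_eq ?_)
      unfold rebuildRate
      ring
    rw [Nat.sub_add_comm hstart, mul_add (creditRate b c)] at hpay
    rw [Nat.sub_self, mul_add (letterRate b c)]
    simp only [Test.cost, Expr.cost, reg, longest, thresholdExpr]
    have : creditRate b c + (scanRate b c + 20) * c + 100 * (maxCount b c + 1) + 100 ≤
        letterRate b c := le_rfl
    omega

lemma wp_step (hb : 0 < b) (hc : 0 < c) (hW : Roomy b c (w.length + 1) W)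
    (hM : maxCount b c < M) (h : Alive b c w T s) :
    Wp M W (w ++ [a]) (step b c) s fun s' t =>
      (Alive b c (w ++ [a]) (T + (1 + t)) s' ∧ s'.var .answer = 1) ∨
        Dead b c (w ++ [a]) (T + (1 + t)) s' := by
  have hl : (w ++ [a]).length = w.length + 1 := by simp
  have hWl : Roomy b c (w ++ [a]).length W := by rwa [hl]
  have hW4 : 4 ≤ W := hW.le (by nlinarith [Nat.zero_le ((b + c) * w.length)])
  refine wp_cond ?_ (fun _ => ?_) (fun hn => absurd h.found_eq (by
    simpa [Test.Holds, Expr.val, reg] using hn))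
  · simp [Test.Fits, Expr.Fits, reg, h.found_eq]
  refine wp_seq ((wp_prepare hb hc hW hM h).mono ?_)
  rintro s₁ t₁ ⟨h1, h2, h3, h4, h5, hbase, h6, h7, h8, h9⟩
  refine wp_seq ((wp_inspect hWl hM h4 h1 (fun j hj => ?_)).mono ?_)
  · have := (h2 j hj).2.1.1
    omega
  rintro s₂ t₂ ⟨g1, g2, g3, g4, g5⟩
  rw [← matchFree_iff hb hc (by simp) (by simpa using h.matchFree) h2 (by rwa [hl]) h3 h6
    (by rwa [hl]) (by rwa [hl])] at g4
  have hcnt : t₂ ≤ 40 * (maxCount b c + 1) := g5.trans (by omega)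
  refine wp_assign ?_ ?_
  · simp [Expr.Fits, reg]; omega
  have e := fun x h h' => g1 x h h'
  simp only [Test.cost, Expr.cost, reg, Expr.val]
  by_cases hf : MatchFree b c (w ++ [a])
  · refine Or.inl ⟨⟨?_, hf, ?_, ?_, ?_, ?_, ?_, ?_, ?_, ?_⟩, ?_⟩
    · simpa using g4.2 hf
    · simpa [g1] using h5
    · simpa [g1] using hbase
    · simpa [g1] using h7
    · simpa [g1] using h8
    · simpa [Tracked, g1, g2] using h2
    · simpa [Complete, g1, g2] using h3
    · simpa [g1] using h4
    · simp [g1]; omega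
    · simp [g4.2 hf]
  · have hfound : s₂.var .found = 1 := by
      have := mt g4.1 hf
      omega
    refine Or.inr ⟨by simpa using hfound, by simp [hfound], hf, ?_⟩
    rw [hl]; omega

lemma wp_step_of_dead (hb : 1 ≤ W) (h : Dead b c w T s) :
    Wp M W (w ++ [a]) (step b c) s fun s' t => Dead b c (w ++ [a]) (T + (1 + t)) s' := by
  refine wp_cond ?_ (fun hn => absurd h.found_eq (by
    simp [Test.Holds, Expr.val, reg] at hn; omega)) (fun _ => wp_skip ?_)
  · simpa [Test.Fits, Expr.Fits, reg, h.found_eq] using hb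
  · refine ⟨h.found_eq, h.answer_eq, fun hf => h.not_matchFree (matchFree_append hf), ?_⟩
    have h1 := h.time_le
    have h2 : 100 ≤ letterRate b c := by unfold letterRate; omega
    simp only [List.length_append, List.length_singleton, mul_add, mul_one, Test.cost, Expr.cost,
      reg]
    omega

end Step

end Detector

/-- The resources M and W are fixed by n, independently of w, so that the induction over prefixes
uses the same machine throughout. -/
lemma exists_run {α : Type u} {b c M W n : ℕ} (hb : 0 < b) (hc : 0 < c)
    (hW : Detector.Roomy b c n W) (hM : Detector.maxCount b c < M) (w : List α) :
    w.length ≤ n → ∃ (T : ℕ) (ans : List Bool) (s : Store Reg Table),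
      (detector b c).Run M W w T ans s ∧
      (Detector.Alive b c w T s ∨ Detector.Dead b c w T s) ∧
      ans.length = w.length ∧
      ∀ k < w.length, (ans[k]? = some true ↔ MatchFree b c (w.take (k + 1))) := by
  induction w using List.reverseRecOn with
  | nil => exact fun _ => ⟨0, [], _, .start, Or.inl Detector.alive_zero, rfl, by simp⟩
  | append_singleton w a ih =>
    intro hn
    rw [List.length_append, List.length_singleton] at hn
    obtain ⟨T, ans, s, hrun, hs, hlen, hans⟩ := ih (by omega)
    have hW' : Detector.Roomy b c (w.length + 1) W :=
      le_trans (Nat.mul_le_mul_left _ (by omega)) hW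
    have hstep : Wp M W (w ++ [a]) (Detector.step b c) s fun s' t =>
        (Detector.Alive b c (w ++ [a]) (T + (1 + t)) s' ∧ s'.var .answer = 1) ∨
          Detector.Dead b c (w ++ [a]) (T + (1 + t)) s' := by
      rcases hs with hs | hs
      · exact Detector.wp_step hb hc hW' hM hs
      · exact (Detector.wp_step_of_dead (hW'.le (by
          nlinarith [Nat.zero_le ((b + c) * w.length)])) hs).mono fun _ _ => Or.inr
    obtain ⟨t, s', hexec, hs'⟩ := hstep
    have hanswer : s'.var .answer ≠ 0 ↔ MatchFree b c (w ++ [a]) := by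
      rcases hs' with ⟨h1, h2⟩ | h
      · exact ⟨fun _ => h1.matchFree, fun _ => by omega⟩
      · exact ⟨fun h' => absurd h.answer_eq h', fun h' => absurd h' h.not_matchFree⟩
    refine ⟨_, _, s', .read a hrun hexec, hs'.imp_left And.left, by simp [hlen], fun k hk => ?_⟩
    rw [List.length_append, List.length_singleton] at hk
    rcases Nat.lt_succ_iff_lt_or_eq.1 hk with h | rfl
    · rw [List.getElem?_append_left (by omega), List.take_append_of_le_length (by omega)]
      exact hans k h
    · rw [← hlen, List.getElem?_concat_length, hlen, List.take_of_length_le (by simp), ← hanswer]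
      rw [Option.some_inj]
      exact decide_eq_true_iff

end OnlineRep

/-- For every rational `e > 1` there are an online algorithm `P`, which may read at each prefix the
length of its shortest unioccurrent suffix, and a constant `C` such that, over every alphabet and on
every string `w`, the algorithm decides for each nonempty prefix of `w`, right after reading its last
letter, whether it is `e`-repetition-free, using at most `C * |w|` steps altogether, at most
`C * (|w| + 1)` memory cells, and only numbers up to `C * (|w| + 1)`. -/
theorem lemma5 (e : ℚ) (he : 1 < e) :
    ∃ (P : OnlineRep.OnlineAlgorithm) (C : ℕ), ∀ (α : Type u) (w : List α),
      ∃ (M T : ℕ) (ans : List Bool) (s : OnlineRep.Store P.V P.A),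
        P.Run M (C * (w.length + 1)) w T ans s ∧
        T ≤ C * w.length ∧
        P.space M w.length ≤ C * (w.length + 1) ∧
        ans.length = w.length ∧
        ∀ k : ℕ, k < w.length →
          (ans[k]? = some true ↔ OnlineRep.RepetitionFree e (w.take (k + 1))) := by
  open OnlineRep Detector in
  obtain ⟨b, c, hb, hc, hbc⟩ : ∃ b c : ℕ, 0 < b ∧ 0 < c ∧ e * b = b + c := by
    have h1 : (e.den : ℤ) < e.num := by
      have := (Rat.lt_iff 1 e).1 he
      simpa using this
    -- b is the denominator of e, and c the numerator of e - 1 over it, positive since e > 1.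
    refine ⟨e.den, (e.num - e.den).toNat, e.den_pos, by omega, ?_⟩
    have h2 : (((e.num - e.den).toNat : ℤ) : ℚ) = ((e.num - e.den : ℤ) : ℚ) := by
      rw [Int.toNat_of_nonneg (by omega)]
    rw [Rat.mul_den_eq_num]
    push_cast at h2
    rw [h2]; ring
  -- The summands serve the word size, the running time, two arrays of `maxCount b c + 1` cells, and
  -- the 8 variables together with the text.
  set K := 16 * (b + c + 1) ^ 2 + letterRate b c + 2 * (maxCount b c + 1) + 9 with hK
  refine ⟨detector b c, K, fun α w => ?_⟩
  have hW : Roomy b c w.length (K * (w.length + 1)) := Nat.mul_le_mul_right _ (by omega)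
  obtain ⟨T, ans, s, hrun, hs, hlen, hans⟩ := exists_run hb hc hW (Nat.lt_succ_self _) w le_rfl
  refine ⟨_, T, ans, s, hrun, ?_, ?_, hlen, fun k hk => ?_⟩
  · refine le_trans ?_ (Nat.mul_le_mul_right _ (show letterRate b c ≤ K by omega))
    rcases hs with hs | hs
    · have := hs.time_le
      omega
    · exact hs.time_le
  · have hV : Fintype.card (detector b c).V = 8 := rfl
    have hA : Fintype.card (detector b c).A = 2 := rfl
    rw [OnlineAlgorithm.space, hV, hA]
    nlinarith [Nat.zero_le (w.length * (16 * (b + c + 1) ^ 2 + letterRate b c +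
      2 * (maxCount b c + 1) + 8)), Nat.zero_le (16 * (b + c + 1) ^ 2)]
  · rw [hans k hk, repetitionFree_iff_matchFree hb hbc]
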